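/- **Setting.** Let $\mathbb{B}$ be the closed unit ball of $\mathbb{R}^n$, let $C,D\subseteq\mathbb{R}^n$, and let $F,G:\mathbb{R}^n\rightrightarrows\mathbb{R}^n$ be set-valued maps. For $\delta\ge 0$ let $\mathcal{H}_\delta$ be the hybrid system $$\dot x\in F_\delta(x)\ \ (x\in C_\delta),\qquad x^+\in G_\delta(x)\ \ (x\in D_\delta),$$ where $C_\delta=C+\delta\mathbb{B}$, $D_\delta=D+\delta\mathbb{B}$, $F_\delta(x)=F(x)+\delta\mathbb{B}$, $G_\delta(x)=G(x)+\delta\mathbb{B}$. Assume that $\mathcal{H}_\delta$ satisfies the basic conditions: $C_\delta$ and $D_\delta$ are closed; $F_\delta$ is outer semicontinuous and locally bounded relative to $C_\delta$, with convex values on $C_\delta$; $G_\delta$ is outer semicontinuous and locally bounded relative to $D_\delta$. (Values may be empty.) **Solutions.** A hybrid time domain is a set $\bigcup_j [t_j,t_{j+1}]\times\{j\}\subseteq\mathbb{R}_{\ge0}\times\mathbb{N}$ with $0=t_0\le t_1\le\cdots$, over all $j\in\mathbb{N}$ or over $0\le j\le J$; in the finite case the last interval may also be $[t_J,b)$ or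 $[t_J,\infty)$. A hybrid arc is a function $\phi$ from a hybrid time domain $\operatorname{dom}\phi$ to $\mathbb{R}^n$ such that, for each $j$, $t\mapsto\phi(t,j)$ is locally absolutely continuous on $I^j=\{t:(t,j)\in\operatorname{dom}\phi\}$. It is a solution to $\mathcal{H}_\delta$ if - $\phi(0,0)\in\overline{C_\delta}\cup D_\delta$; - whenever $\operatorname{int}I^j\ne\emptyset$, $\phi(t,j)\in C_\delta$ for all $t\in\operatorname{int}I^j$ and $\dot\phi(t,j)\in F_\delta(\phi(t,j))$ for almost all $t\in I^j$; - whenever $(t,j),(t,j+1)\in\operatorname{dom}\phi$, $\phi(t,j)\in D_\delta$ and $\phi(t,j+1)\in G_\delta(\phi(t,j))$. A solution is maximal if no solution extends it to a strictly larger domain, bounded if its range $\operatorname{rge}\phi$ is bounded, and complete if $\operatorname{dom}\phi$ is unbounded. **Stability and safety.** Write $|x|_A=\inf_{y\in A}|x-y|$ (with $\inf\emptyset=\infty$). - A closed set $A$ is uniformly pre-asymptotically stable (UpAS) for $\mathcal{H}_\delta$ if (i) for every $\varepsilon>0$ there is $\eta>0$ such that every solution with $|\phi(0,0)|_A<\eta$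 satisfies $|\phi(t,j)|_A<\varepsilon$ on $\operatorname{dom}\phi$; and (ii) there is $\rho>0$ such that for every $\varepsilon>0$ there is $T>0$ such that every solution with $|\phi(0,0)|_A<\rho$ satisfies $|\phi(t,j)|_A<\varepsilon$ for all $(t,j)\in\operatorname{dom}\phi$ with $t+j\ge T$. - The basin of pre-attraction $\mathfrak{B}_\delta(A)$ is the set of $x\in\mathbb{R}^n$ such that every solution $\phi$ with $\phi(0,0)=x$ is bounded and, if complete, satisfies $|\phi(t,j)|_A\to0$ as $t+j\to\infty$. - $\mathcal{H}_\delta$ satisfies the stability with safety guarantee specification $(\mathcal{X}_0,U,A)$ if $A$ is closed and UpAS for $\mathcal{H}_\delta$, $\mathcal{X}_0\subseteq\mathfrak{B}_\delta(A)$, and $\operatorname{rge}\phi\cap U=\emptyset$ for every maximal solution $\phi$ starting in $\mathcal{X}_0$. - The basin of pre-attraction with safety $\widehat{\mathfrak{B}}_\delta(A)$ is the set of $x\in\mathfrak{B}_\delta(A)$ such that $\operatorname{rge}\phi\cap U=\emptyset$ for every maximal solution $\phi$ with $\phi(0,0)=x$. - A set $I$ is forward pre-invariant for $\mathcal{H}_\delta$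 if $\operatorname{rge}\phi\subseteq I$ for every maximal solution $\phi$ starting in $I$. **Lemma.** Let $\mathcal{X}_0,U,A\subseteq\mathbb{R}^n$ with $A$ compact, $U$ closed and $A\cap U=\emptyset$. If $\mathcal{H}_\delta$ satisfies the stability with safety guarantee specification $(\mathcal{X}_0,U,A)$, then 1. $\mathcal{X}_0\subseteq\widehat{\mathfrak{B}}_\delta(A)\subseteq\mathfrak{B}_\delta(A)$; 2. $\widehat{\mathfrak{B}}_\delta(A)$ is open and forward pre-invariant for $\mathcal{H}_\delta$. -/

import Mathlib

open scoped Pointwise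

/-- The Euclidean space of dimension `n`. -/
abbrev EucSpace (n : ℕ) : Type := EuclideanSpace ℝ (Fin n)

/-- A hybrid time domain: a union of intervals `[t_j, t_{j+1}] × {j}` with
`0 = t_0 ≤ t_1 ≤ t_2 ≤ ⋯`, over all `j` or over `j ≤ J`; in the finite case the last interval `L`
starts at `t_J` and is `[t_J, b]`, `[t_J, b)` or `[t_J, ∞)`. -/
def IsHybridTimeDomain (E : Set (ℝ × ℕ)) : Prop :=
  ∃ t : ℕ → ℝ, t 0 = 0 ∧ Monotone t ∧
    (E = {p | t p.2 ≤ p.1 ∧ p.1 ≤ t (p.2 + 1)} ∨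
      ∃ (J : ℕ) (L : Set ℝ), IsLeast L (t J) ∧ L.OrdConnected ∧
        E = {p | p.2 < J ∧ t p.2 ≤ p.1 ∧ p.1 ≤ t (p.2 + 1)} ∪ {p | p.2 = J ∧ p.1 ∈ L})

/-- A hybrid arc in `ℝⁿ`: a function on a hybrid time domain `dom` that is locally absolutely
continuous in `t` on each `I^j = {t | (t, j) ∈ dom}`. Values off `dom` carry no meaning. -/
structure HybridArc (n : ℕ) where
  dom : Set (ℝ × ℕ)
  toFun : ℝ → ℕ → EucSpace n
  isHybridTimeDomain : IsHybridTimeDomain dom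
  locallyAbsolutelyContinuous : ∀ (j : ℕ) (a b : ℝ), (a, j) ∈ dom → (b, j) ∈ dom →
    AbsolutelyContinuousOnInterval (fun t => toFun t j) a b

namespace HybridArc

variable {n : ℕ}

/-- The interval `I^j`. -/
def flowInterval (φ : HybridArc n) (j : ℕ) : Set ℝ := {t | (t, j) ∈ φ.dom}

/-- The range of a hybrid arc. -/
def rge (φ : HybridArc n) : Set (EucSpace n) := {y | ∃ t j, (t, j) ∈ φ.dom ∧ φ.toFun t j = y}

/-- A hybrid arc is complete if its domain is unbounded. -/
def IsComplete (φ : HybridArc n) : Prop := ∀ T : ℝ, ∃ t j, (t, j) ∈ φ.dom ∧ T ≤ t + (j : ℝ)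

/-- `|φ(t,j)|_A → 0` as `t + j → ∞`. The distance to `A` is extended-real valued, with value `∞`
if `A` is empty. -/
def ConvergesTo (φ : HybridArc n) (A : Set (EucSpace n)) : Prop :=
  ∀ ε : ℝ, 0 < ε → ∃ T : ℝ, ∀ t j, (t, j) ∈ φ.dom → T ≤ t + (j : ℝ) →
    Metric.infEDist (φ.toFun t j) A < ENNReal.ofReal ε

end HybridArc

/-- A set-valued map `M` is outer semicontinuous relative to `S`. -/
def OuterSemicontinuousRel {n : ℕ} (M : EucSpace n → Set (EucSpace n)) (S : Set (EucSpace n)) :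
    Prop :=
  ∀ x ∈ S, ∀ (u v : ℕ → EucSpace n) (y : EucSpace n), (∀ i, u i ∈ S) → (∀ i, v i ∈ M (u i)) →
    Filter.Tendsto u Filter.atTop (nhds x) → Filter.Tendsto v Filter.atTop (nhds y) → y ∈ M x

/-- A set-valued map `M` is locally bounded relative to `S`. -/
def LocallyBoundedRel {n : ℕ} (M : EucSpace n → Set (EucSpace n)) (S : Set (EucSpace n)) : Prop :=
  ∀ x ∈ S, ∃ N ∈ nhds x, Bornology.IsBounded (⋃ z ∈ N ∩ S, M z)

/-- The data `(C, F, D, G)` of a hybrid system `ẋ ∈ F(x), x ∈ C`; `x⁺ ∈ G(x), x ∈ D` on `ℝⁿ`. -/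
structure HybridSystem (n : ℕ) where
  C : Set (EucSpace n)
  F : EucSpace n → Set (EucSpace n)
  D : Set (EucSpace n)
  G : EucSpace n → Set (EucSpace n)

namespace HybridSystem

variable {n : ℕ}

/-- The additive `δ`-perturbation: `ẋ ∈ F(x) + δB` on `C + δB` and `x⁺ ∈ G(x) + δB` on `D + δB`,
where `B` is the closed unit ball. -/
def perturb (H : HybridSystem n) (δ : ℝ) : HybridSystem n where
  C := H.C + Metric.closedBall 0 δ
  F := fun x => H.F x + Metric.closedBall 0 δ
  D := H.D + Metric.closedBall 0 δ
  G := fun x => H.G x + Metric.closedBall 0 δ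

/-- The basic conditions (values of `F` and `G` are allowed to be empty). -/
structure BasicConditions (H : HybridSystem n) : Prop where
  isClosed_C : IsClosed H.C
  isClosed_D : IsClosed H.D
  osc_F : OuterSemicontinuousRel H.F H.C
  locallyBounded_F : LocallyBoundedRel H.F H.C
  convex_F : ∀ x ∈ H.C, Convex ℝ (H.F x)
  osc_G : OuterSemicontinuousRel H.G H.D
  locallyBounded_G : LocallyBoundedRel H.G H.D

/-- `φ` is a solution to the hybrid system `H`. -/
structure IsSolution (H : HybridSystem n) (φ : HybridArc n) : Prop where
  init : φ.toFun 0 0 ∈ closure H.C ∪ H.D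
  flow_mem : ∀ j, ∀ t ∈ interior (φ.flowInterval j), φ.toFun t j ∈ H.C
  flow_deriv : ∀ j, (interior (φ.flowInterval j)).Nonempty →
    ∀ᵐ t ∂(MeasureTheory.volume.restrict (φ.flowInterval j)),
      ∃ v ∈ H.F (φ.toFun t j), HasDerivAt (fun s => φ.toFun s j) v t
  jump : ∀ t j, (t, j) ∈ φ.dom → (t, j + 1) ∈ φ.dom →
    φ.toFun t j ∈ H.D ∧ φ.toFun t (j + 1) ∈ H.G (φ.toFun t j)

/-- A solution is maximal if no solution extends it to a strictly larger domain. -/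
def IsMaximalSolution (H : HybridSystem n) (φ : HybridArc n) : Prop :=
  H.IsSolution φ ∧ ¬ ∃ ψ : HybridArc n, H.IsSolution ψ ∧ φ.dom ⊂ ψ.dom ∧
    ∀ t j, (t, j) ∈ φ.dom → φ.toFun t j = ψ.toFun t j

/-- The set of all maximal solutions starting from the set `K`. -/
def maximalSolutions (H : HybridSystem n) (K : Set (EucSpace n)) : Set (HybridArc n) :=
  {φ | H.IsMaximalSolution φ ∧ φ.toFun 0 0 ∈ K}

/-- Forward pre-invariance of a set. -/
def ForwardPreInvariant (H : HybridSystem n) (I : Set (EucSpace n)) : Prop :=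
  ∀ φ ∈ H.maximalSolutions I, φ.rge ⊆ I

/-- Uniform stability of a set. -/
def UniformlyStable (H : HybridSystem n) (A : Set (EucSpace n)) : Prop :=
  ∀ ε : ℝ, 0 < ε → ∃ η : ℝ, 0 < η ∧ ∀ φ, H.IsSolution φ →
    Metric.infEDist (φ.toFun 0 0) A < ENNReal.ofReal η →
      ∀ t j, (t, j) ∈ φ.dom → Metric.infEDist (φ.toFun t j) A < ENNReal.ofReal ε

/-- Uniform pre-attractivity of a set. -/
def UniformlyPreAttractive (H : HybridSystem n) (A : Set (EucSpace n)) : Prop :=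
  ∃ ρ : ℝ, 0 < ρ ∧ ∀ ε : ℝ, 0 < ε → ∃ T : ℝ, 0 < T ∧ ∀ φ, H.IsSolution φ →
    Metric.infEDist (φ.toFun 0 0) A < ENNReal.ofReal ρ →
      ∀ t j, (t, j) ∈ φ.dom → T ≤ t + (j : ℝ) →
        Metric.infEDist (φ.toFun t j) A < ENNReal.ofReal ε

/-- Uniform pre-asymptotic stability of a closed set. -/
def UpAS (H : HybridSystem n) (A : Set (EucSpace n)) : Prop :=
  IsClosed A ∧ H.UniformlyStable A ∧ H.UniformlyPreAttractive A

/-- The basin of pre-attraction of `A`. -/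
def basin (H : HybridSystem n) (A : Set (EucSpace n)) : Set (EucSpace n) :=
  {x | ∀ φ, H.IsSolution φ → φ.toFun 0 0 = x →
    Bornology.IsBounded φ.rge ∧ (φ.IsComplete → φ.ConvergesTo A)}

/-- The stability with safety guarantee specification `(X₀, U, A)`. -/
structure StabilityWithSafety (H : HybridSystem n) (X₀ U A : Set (EucSpace n)) : Prop where
  upAS : H.UpAS A
  subset_basin : X₀ ⊆ H.basin A
  safe : ∀ φ ∈ H.maximalSolutions X₀, φ.rge ∩ U = ∅

/-- The basin of pre-attraction of `A` with safety with respect to `U`. -/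
def safeBasin (H : HybridSystem n) (U A : Set (EucSpace n)) : Set (EucSpace n) :=
  {x ∈ H.basin A | ∀ φ ∈ H.maximalSolutions {x}, φ.rge ∩ U = ∅}

end HybridSystem

/-! Since every solution extends to a maximal one, membership in the basin with safety can be tested
on all solutions (`mem_safeBasin_iff`). Solutions concatenate, so every point reached from the basin
with safety is again in it and outside `U`; this is pre-invariance.

Openness is proved by contradiction. Let `S` be the closure of the complement of `safeBasin \ U`,
and suppose that some `x` in the basin with safety is a limit of points outside it, so that `x ∈ S`.
Zorn's lemma gives a solution `ψ` from `x` that is maximal among those with values in `S`. It is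
bounded. It is not complete: it would converge to `A`, whereas stability, attractivity and the
positive distance from `A` to `U` put a whole neighborhood of `A` inside `safeBasin \ U`, hence off
`S`. So its domain is bounded; a bounded flow has bounded speed, so it extends to the right endpoint
of its last interval, and maximality forces the domain to have a last point. The value there lies in
`safeBasin \ U` and in `S`, and `exists_isSolution_boundary` supplies a nontrivial continuation
inside `S`, contradicting maximality.

That continuation comes from a local compactness argument. Near such a boundary point `z` there are
points from which some solution is not safely attracted. As long as these solutions stay in a small
ball away from `U`, their values remain outside `safeBasin \ U`. Along an ultrafilter tending to
`z`, either they share a flow time of positive length, and their limit is a flow, or they jump after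
times tending to 0, and their limit is a jump from `z`. Only this one step needs a limit, so no
convergence theory for whole hybrid arcs is involved. -/

open Set Filter Topology MeasureTheory

/-! ### Absolutely continuous curves -/

namespace AbsolutelyContinuousOnInterval

theorem congr {X : Type*} [PseudoMetricSpace X] {f g : ℝ → X} {a b : ℝ}
    (hf : AbsolutelyContinuousOnInterval f a b) (h : EqOn f g (uIcc a b)) :
    AbsolutelyContinuousOnInterval g a b := by
  rw [absolutelyContinuousOnInterval_iff] at hf ⊢
  intro ε hε
  obtain ⟨δ, hδ, H⟩ := hf ε hε
  refine ⟨δ, hδ, fun E hE hlen => ?_⟩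
  refine lt_of_eq_of_lt (Finset.sum_congr rfl fun i hi => ?_) (H E hE hlen)
  rw [h (hE.1 i hi).1, h (hE.1 i hi).2]

/-- Clipping a disjoint family of intervals at `b` gives two disjoint families of no larger total
length, one on each side. By the triangle inequality the oscillation sum splits accordingly. -/
theorem trans {X : Type*} [PseudoMetricSpace X] {f : ℝ → X} {a b c : ℝ}
    (hab : a ≤ b) (hbc : b ≤ c) (h₁ : AbsolutelyContinuousOnInterval f a b)
    (h₂ : AbsolutelyContinuousOnInterval f b c) : AbsolutelyContinuousOnInterval f a c := by
  rw [absolutelyContinuousOnInterval_iff] at h₁ h₂ ⊢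
  intro ε hε
  obtain ⟨δ₁, hδ₁, H₁⟩ := h₁ (ε / 2) (half_pos hε)
  obtain ⟨δ₂, hδ₂, H₂⟩ := h₂ (ε / 2) (half_pos hε)
  refine ⟨min δ₁ δ₂, lt_min hδ₁ hδ₂, fun E hE hlen => ?_⟩
  obtain ⟨hmem, hdisj⟩ := hE
  rw [uIcc_of_le (hab.trans hbc)] at hmem
  have l₁ := H₁ (E.1, fun i => (min (E.2 i).1 b, min (E.2 i).2 b)) ⟨fun i hi => by
      have := hmem i hi
      rw [uIcc_of_le hab]
      simp only [mem_Icc] at this ⊢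
      grind, hdisj.mono fun i x hx => by
      simp only [mem_uIoc] at hx ⊢
      grind⟩ (lt_of_le_of_lt (Finset.sum_le_sum fun i _ => by
        simp only [Real.dist_eq]
        exact abs_min_sub_min_le_max _ _ _ _ |>.trans (by simp)) (hlen.trans_le (min_le_left _ _)))
  have l₂ := H₂ (E.1, fun i => (max (E.2 i).1 b, max (E.2 i).2 b)) ⟨fun i hi => by
      have := hmem i hi
      rw [uIcc_of_le hbc]
      simp only [mem_Icc] at this ⊢
      grind, hdisj.mono fun i x hx => by
      simp only [mem_uIoc] at hx ⊢
      grind⟩ (lt_of_le_of_lt (Finset.sum_le_sum fun i _ => by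
        simp only [Real.dist_eq]
        exact abs_max_sub_max_le_max _ _ _ _ |>.trans (by simp)) (hlen.trans_le (min_le_right _ _)))
  have l₃ := add_lt_add l₁ l₂
  rw [add_halves] at l₃
  refine lt_of_le_of_lt ?_ l₃
  · rw [← Finset.sum_add_distrib]
    refine Finset.sum_le_sum fun i _ => ?_
    rcases le_total (E.2 i).1 b with h | h <;> rcases le_total (E.2 i).2 b with h' | h' <;>
      simp [h, h', dist_triangle]
    rw [add_comm]; exact dist_triangle _ _ _

theorem comp_sub_const {X : Type*} [PseudoMetricSpace X] {f : ℝ → X} {a b : ℝ} (c : ℝ)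
    (hf : AbsolutelyContinuousOnInterval f (a - c) (b - c)) :
    AbsolutelyContinuousOnInterval (fun t => f (t - c)) a b := by
  rw [absolutelyContinuousOnInterval_iff] at hf ⊢
  intro ε hε
  obtain ⟨δ, hδ, H⟩ := hf ε hε
  refine ⟨δ, hδ, fun E hE hlen => ?_⟩
  refine H (E.1, fun i => ((E.2 i).1 - c, (E.2 i).2 - c)) ⟨fun i hi => ?_, ?_⟩ (by simpa using hlen)
  · have := hE.1 i hi
    simp only [mem_uIcc] at this ⊢
    grind
  · intro i hi j hj hij
    refine Set.disjoint_left.2 fun x hx hx' =>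
      (Set.disjoint_left.1 (hE.2 hi hj hij) : ∀ ⦃y⦄, _ → _) (?_ : x + c ∈ _) ?_ <;>
      simp only [mem_uIoc] at hx hx' ⊢ <;> grind

theorem clm_comp {E F : Type*} [NormedAddCommGroup E] [NormedSpace ℝ E] [NormedAddCommGroup F]
    [NormedSpace ℝ F] {f : ℝ → E} {a b : ℝ} (hf : AbsolutelyContinuousOnInterval f a b)
    (l : E →L[ℝ] F) : AbsolutelyContinuousOnInterval (fun t => l (f t)) a b := by
  apply squeeze_zero (fun t ↦ ?_) (fun t ↦ ?_)
    (by simpa using Tendsto.const_mul ‖l‖ hf)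
  · exact Finset.sum_nonneg (fun i hi ↦ by positivity)
  · rw [Finset.mul_sum]
    gcongr
    exact l.lipschitz.dist_le_mul _ _

/-- Mean value inclusion: the slope of an absolutely continuous curve belongs to every closed
convex set containing its derivatives. -/
theorem slope_mem_of_ae_deriv_mem {E : Type*} [NormedAddCommGroup E] [NormedSpace ℝ E]
    {f : ℝ → E} {a b : ℝ} (hab : a < b) (hf : AbsolutelyContinuousOnInterval f a b)
    {K : Set E} (hK : IsClosed K) (hKc : Convex ℝ K)
    (hd : ∀ᵐ t, t ∈ Ioo a b → ∃ v ∈ K, HasDerivAt f v t) :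
    (b - a)⁻¹ • (f b - f a) ∈ K := by
  by_contra hx
  -- A functional separating the slope from `K` bounds its derivative along the curve by `u`;
  -- integrating bounds the slope by `u` too, a contradiction.
  obtain ⟨l, u, hl, hu⟩ := geometric_hahn_banach_closed_point hKc hK hx
  have hl_ac := hf.clm_comp l
  have hint := hl_ac.integral_deriv_eq_sub
  have hle : ∫ t in a..b, deriv (fun t => l (f t)) t ≤ ∫ _t in a..b, u := by
    refine intervalIntegral.integral_mono_ae_restrict hab.le hl_ac.intervalIntegrable_deriv
      intervalIntegrable_const ?_
    rw [← restrict_Ioo_eq_restrict_Icc, EventuallyLE, ae_restrict_iff' measurableSet_Ioo]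
    filter_upwards [hd] with t ht hmem
    obtain ⟨v, hv, hdv⟩ := ht hmem
    have := (l.hasFDerivAt.comp_hasDerivAt t hdv).deriv
    simp only [Function.comp_def] at this
    rw [this]
    exact (hl v hv).le
  rw [hint, intervalIntegral.integral_const, smul_eq_mul] at hle
  rw [map_smul, map_sub, smul_eq_mul, inv_mul_eq_div, lt_div_iff₀ (sub_pos.2 hab)] at hu
  linarith

end AbsolutelyContinuousOnInterval

/-! ### Flows on compact intervals -/

namespace HybridSystem

variable {n : ℕ}

/-- `f` is a flow of `H` on the compact interval `[a, b]`. -/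
structure IsFlow (H : HybridSystem n) (f : ℝ → EucSpace n) (a b : ℝ) : Prop where
  ac : AbsolutelyContinuousOnInterval f a b
  mem : ∀ t ∈ Ioo a b, f t ∈ H.C
  ae_deriv : ∀ᵐ t, t ∈ Ioo a b → ∃ v ∈ H.F (f t), HasDerivAt f v t

namespace IsFlow

variable {H : HybridSystem n} {f g : ℝ → EucSpace n} {a b c d : ℝ}

theorem mono (h : H.IsFlow f a b) (hac : a ≤ c) (hcd : c ≤ d) (hdb : d ≤ b) :
    H.IsFlow f c d where
  ac := h.ac.mono (by
    rw [uIcc_of_le hcd, uIcc_of_le (hac.trans (hcd.trans hdb))]; exact Icc_subset_Icc hac hdb)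
  mem t ht := h.mem t (Ioo_subset_Ioo hac hdb ht)
  ae_deriv := h.ae_deriv.mono fun _ ht hm => ht (Ioo_subset_Ioo hac hdb hm)

theorem refl (H : HybridSystem n) (f : ℝ → EucSpace n) (a : ℝ) : H.IsFlow f a a where
  ac := by
    refine (LipschitzOnWith.absolutelyContinuousOnInterval (K := 0) ?_)
    rw [uIcc_self]; simp
  mem := by simp
  ae_deriv := by simp

theorem congr (h : H.IsFlow f a b) (hab : a ≤ b) (hfg : EqOn f g (Icc a b)) : H.IsFlow g a b where
  ac := h.ac.congr (by rwa [uIcc_of_le hab])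
  mem t ht := hfg (Ioo_subset_Icc_self ht) ▸ h.mem t ht
  ae_deriv := by
    filter_upwards [h.ae_deriv] with t ht hm
    obtain ⟨v, hv, hd⟩ := ht hm
    refine ⟨v, hfg (Ioo_subset_Icc_self hm) ▸ hv, hd.congr_of_eventuallyEq ?_⟩
    filter_upwards [Ioo_mem_nhds hm.1 hm.2] with s hs
    exact (hfg (Ioo_subset_Icc_self hs)).symm

/-- The flow constraint is imposed on the open interval only; continuity and closedness of `C` carry
it to the endpoints, provided the interval is nondegenerate. -/
theorem mem_Icc (h : H.IsFlow f a b) (hC : IsClosed H.C) (hab : a < b) :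
    ∀ t ∈ Icc a b, f t ∈ H.C := by
  have hc : ContinuousOn f (Icc a b) := uIcc_of_le hab.le ▸ h.ac.continuousOn
  intro t ht
  rw [← closure_Ioo hab.ne] at ht hc
  exact hC.closure_subset ((hc t ht).mono subset_closure |>.mem_closure ht h.mem)

theorem trans (hC : IsClosed H.C) (hab : a ≤ b) (hbc : b ≤ c) (h₁ : H.IsFlow f a b)
    (h₂ : H.IsFlow f b c) : H.IsFlow f a c where
  ac := h₁.ac.trans hab hbc h₂.ac
  mem t ht := by
    rcases lt_trichotomy t b with h | rfl | h
    · exact h₁.mem t ⟨ht.1, h⟩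
    · exact h₁.mem_Icc hC ht.1 t ⟨ht.1.le, le_rfl⟩
    · exact h₂.mem t ⟨h, ht.2⟩
  ae_deriv := by
    filter_upwards [h₁.ae_deriv, h₂.ae_deriv, Measure.ae_ne volume b] with t ht₁ ht₂ hne ht
    rcases lt_or_gt_of_ne hne with h | h
    · exact ht₁ ⟨ht.1, h⟩
    · exact ht₂ ⟨h, ht.2⟩

theorem comp_sub_const (c : ℝ) (h : H.IsFlow f (a - c) (b - c)) :
    H.IsFlow (fun t => f (t - c)) a b where
  ac := h.ac.comp_sub_const c
  mem t ht := h.mem (t - c) ⟨by linarith [ht.1], by linarith [ht.2]⟩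
  ae_deriv := by
    have := (measurePreserving_sub_right volume c).quasiMeasurePreserving.ae h.ae_deriv
    filter_upwards [this] with t ht hm
    obtain ⟨v, hv, hd⟩ := ht ⟨by linarith [hm.1], by linarith [hm.2]⟩
    exact ⟨v, hv, hd.comp_sub_const t c⟩

theorem slope_mem (h : H.IsFlow f a b) (hab : a < b) {K : Set (EucSpace n)} (hK : IsClosed K)
    (hKc : Convex ℝ K) (hF : ∀ t ∈ Ioo a b, H.F (f t) ⊆ K) : (b - a)⁻¹ • (f b - f a) ∈ K :=
  h.ac.slope_mem_of_ae_deriv_mem hab hK hKc (by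
    filter_upwards [h.ae_deriv] with t ht hm
    obtain ⟨v, hv, hd⟩ := ht hm
    exact ⟨v, hF t hm hv, hd⟩)

theorem dist_le (h : H.IsFlow f a b) (hab : a ≤ b) {M : ℝ}
    (hF : ∀ t ∈ Ioo a b, ∀ v ∈ H.F (f t), ‖v‖ ≤ M) : dist (f a) (f b) ≤ M * (b - a) := by
  rcases hab.eq_or_lt with rfl | hab
  · simp
  have := h.slope_mem hab (K := Metric.closedBall 0 M) Metric.isClosed_closedBall
    (convex_closedBall _ _) fun t ht v hv => by simpa using hF t ht v hv
  rw [mem_closedBall_zero_iff, norm_smul, norm_inv, Real.norm_of_nonneg (sub_pos.2 hab).le,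
    inv_mul_le_iff₀ (sub_pos.2 hab)] at this
  rw [dist_comm, dist_eq_norm]
  linarith

end IsFlow

end HybridSystem

/-! ### Outer semicontinuous and locally bounded maps -/

section SetValued

variable {n : ℕ} {M : EucSpace n → Set (EucSpace n)} {S : Set (EucSpace n)}

/-- The definition speaks of sequences. Closure points in a metric space are sequential limits, so
it passes to arbitrary filters, in particular to ultrafilters. -/
theorem OuterSemicontinuousRel.mem_of_tendsto (h : OuterSemicontinuousRel M S) {ι : Type*}
    {l : Filter ι} [l.NeBot] {u v : ι → EucSpace n} {x y : EucSpace n} (hx : x ∈ S)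
    (hu : ∀ᶠ i in l, u i ∈ S) (hv : ∀ᶠ i in l, v i ∈ M (u i)) (hux : Tendsto u l (𝓝 x))
    (hvy : Tendsto v l (𝓝 y)) : y ∈ M x := by
  have : (x, y) ∈ closure {p : EucSpace n × EucSpace n | p.1 ∈ S ∧ p.2 ∈ M p.1} :=
    mem_closure_of_tendsto (hux.prodMk_nhds hvy) (hu.and hv)
  obtain ⟨w, hw, hwl⟩ := mem_closure_iff_seq_limit.1 this
  exact h x hx (fun i => (w i).1) (fun i => (w i).2) y (fun i => (hw i).1) (fun i => (hw i).2)
    ((continuous_fst.tendsto _).comp hwl) ((continuous_snd.tendsto _).comp hwl)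

theorem OuterSemicontinuousRel.isClosed (h : OuterSemicontinuousRel M S) {x : EucSpace n}
    (hx : x ∈ S) : IsClosed (M x) :=
  isClosed_of_closure_subset fun y hy => by
    obtain ⟨w, hw, hwl⟩ := mem_closure_iff_seq_limit.1 hy
    exact h x hx (fun _ => x) w y (fun _ => hx) hw tendsto_const_nhds hwl

theorem LocallyBoundedRel.exists_norm_le (h : LocallyBoundedRel M S) {x : EucSpace n}
    (hx : x ∈ S) : ∃ B : ℝ, ∀ᶠ y in 𝓝 x, y ∈ S → ∀ v ∈ M y, ‖v‖ ≤ B := by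
  obtain ⟨N, hN, hb⟩ := h x hx
  obtain ⟨B, hB⟩ := hb.exists_norm_le
  refine ⟨B, ?_⟩
  filter_upwards [hN] with y hy hyS v hv
  exact hB v (mem_biUnion (⟨hy, hyS⟩ : y ∈ N ∩ S) hv)

theorem LocallyBoundedRel.exists_norm_le_of_isClosed (h : LocallyBoundedRel M S)
    (hS : IsClosed S) (x : EucSpace n) :
    ∃ B : ℝ, ∀ᶠ y in 𝓝 x, y ∈ S → ∀ v ∈ M y, ‖v‖ ≤ B := by
  by_cases hx : x ∈ S
  · exact h.exists_norm_le hx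
  · refine ⟨0, ?_⟩
    filter_upwards [hS.isOpen_compl.mem_nhds hx] with y hy hyS
    exact absurd hyS hy

theorem LocallyBoundedRel.exists_norm_le_of_isBounded (h : LocallyBoundedRel M S)
    (hS : IsClosed S) {K : Set (EucSpace n)} (hK : Bornology.IsBounded K) :
    ∃ B : ℝ, ∀ y ∈ K, y ∈ S → ∀ v ∈ M y, ‖v‖ ≤ B := by
  have : ∃ B : ℝ, ∀ y ∈ closure K, y ∈ S → ∀ v ∈ M y, ‖v‖ ≤ B := by
    refine hK.isCompact_closure.induction_on (p := fun K => ∃ B : ℝ, ∀ y ∈ K, y ∈ S →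
      ∀ v ∈ M y, ‖v‖ ≤ B) ⟨0, by simp⟩ ?_ ?_ ?_
    · rintro s t hst ⟨B, hB⟩
      exact ⟨B, fun y hy => hB y (hst hy)⟩
    · rintro s t ⟨B, hB⟩ ⟨B', hB'⟩
      refine ⟨max B B', ?_⟩
      rintro y (hy | hy) hyS v hv
      · exact (hB y hy hyS v hv).trans (le_max_left _ _)
      · exact (hB' y hy hyS v hv).trans (le_max_right _ _)
    · intro x _
      obtain ⟨B, hB⟩ := h.exists_norm_le_of_isClosed hS x
      exact ⟨_, mem_nhdsWithin_of_mem_nhds hB, B, fun y hy => hy⟩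
  obtain ⟨B, hB⟩ := this
  exact ⟨B, fun y hy => hB y (subset_closure hy)⟩

/-- Bounded families have limits along ultrafilters. -/
theorem exists_tendsto_of_eventually_mem_closedBall {ι : Type*} (𝒰 : Ultrafilter ι)
    {u : ι → EucSpace n} {c : EucSpace n} {B : ℝ}
    (h : ∀ᶠ i in (𝒰 : Filter ι), u i ∈ Metric.closedBall c B) :
    ∃ y ∈ Metric.closedBall c B, Tendsto u 𝒰 (𝓝 y) := by
  obtain ⟨y, hy, hle⟩ := (isCompact_closedBall c B).ultrafilter_le_nhds (𝒰.map u)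
    (le_principal_iff.2 h)
  exact ⟨y, hy, hle⟩

/-- An outer semicontinuous locally bounded map is upper semicontinuous. -/
theorem OuterSemicontinuousRel.eventually_subset_cthickening (h : OuterSemicontinuousRel M S)
    (hb : LocallyBoundedRel M S) {x : EucSpace n} (hx : x ∈ S) {ε : ℝ} (hε : 0 < ε) :
    ∀ᶠ y in 𝓝 x, y ∈ S → M y ⊆ Metric.cthickening ε (M x) := by
  by_contra hcon
  obtain ⟨B, hB⟩ := hb.exists_norm_le hx
  have hf : (𝓝 x ⊓ 𝓟 {y | ¬ (y ∈ S → M y ⊆ Metric.cthickening ε (M x))}).NeBot :=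
    frequently_mem_iff_neBot.1 (not_eventually.1 hcon)
  -- An ultrafilter of counterexamples tending to `x`: the offending values are bounded, so they
  -- converge along it to a point of `M x`, and most of them are then close to `M x`.
  obtain ⟨𝒰, hle⟩ := Ultrafilter.exists_le
    (𝓝 x ⊓ 𝓟 {y | ¬ (y ∈ S → M y ⊆ Metric.cthickening ε (M x))})
  obtain ⟨h𝒰x, h𝒰p⟩ := le_inf_iff.1 hle
  have hx𝒰 : Tendsto (fun y => y) (𝒰 : Filter (EucSpace n)) (𝓝 x) := h𝒰x
  have hbad : ∀ᶠ y in (𝒰 : Filter (EucSpace n)),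
      ∃ v, y ∈ S ∧ v ∈ M y ∧ v ∉ Metric.cthickening ε (M x) := by
    filter_upwards [le_principal_iff.1 h𝒰p] with y hy
    by_contra! hc
    exact hy fun hyS v hv => by_contra fun hn => hn (hc v hyS hv)
  obtain ⟨v, hv⟩ := hbad.choice
  obtain ⟨w, -, hw⟩ := exists_tendsto_of_eventually_mem_closedBall 𝒰 (u := v) (c := 0) (B := B) (by
    filter_upwards [hv, hB.filter_mono h𝒰x] with y hy hyB
    exact mem_closedBall_zero_iff.2 (hyB hy.1 _ hy.2.1))
  have hwM : w ∈ M x := h.mem_of_tendsto hx (hv.mono fun y hy => hy.1)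
    (hv.mono fun y hy => hy.2.1) hx𝒰 hw
  have hnear := hw.eventually_mem
    (Metric.isOpen_thickening.mem_nhds (Metric.self_subset_thickening hε _ hwM))
  obtain ⟨y, hy, hy'⟩ := (hv.and hnear).exists
  exact hy.2.2 (Metric.thickening_subset_cthickening _ _ hy')

end SetValued

/-! ### Limits of flows -/

namespace HybridSystem

variable {n : ℕ}

/-- Pointwise limits of equi-Lipschitz flows are flows. -/
theorem IsFlow.of_tendsto {H : HybridSystem n} (hH : H.BasicConditions) {ι : Type*}
    {l : Filter ι} [l.NeBot] {f : ι → ℝ → EucSpace n} {g : ℝ → EucSpace n} {a b : ℝ} {B : NNReal}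
    (hab : a ≤ b) (hlip : ∀ᶠ i in l, LipschitzOnWith B (f i) (Icc a b))
    (hflow : ∀ᶠ i in l, H.IsFlow (f i) a b)
    (hlim : ∀ t ∈ Icc a b, Tendsto (fun i => f i t) l (𝓝 (g t))) : H.IsFlow g a b := by
  have hgl : LipschitzOnWith B g (Icc a b) := by
    refine LipschitzOnWith.of_dist_le_mul fun s hs t ht => ?_
    refine le_of_tendsto ((hlim s hs).dist (hlim t ht)) ?_
    filter_upwards [hlip] with i hi using hi.dist_le_mul s hs t ht
  have hgC : ∀ t ∈ Ioo a b, g t ∈ H.C := fun t ht =>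
    hH.isClosed_C.mem_of_tendsto (hlim t (Ioo_subset_Icc_self ht))
      (hflow.mono fun i hi => hi.mem t ht)
  refine ⟨LipschitzOnWith.absolutelyContinuousOnInterval (K := B) (by rwa [uIcc_of_le hab]),
    hgC, ?_⟩
  filter_upwards [hgl.locallyBoundedVariationOn.ae_differentiableWithinAt_of_mem] with t hdiff ht
  have hd : HasDerivAt g (deriv g t) t :=
    ((hdiff (Ioo_subset_Icc_self ht)).differentiableAt (Icc_mem_nhds ht.1 ht.2)).hasDerivAt
  refine ⟨deriv g t, ?_, hd⟩
  have hcl := hH.osc_F.isClosed (hgC t ht)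
  -- `F (g t)` is closed, so it suffices to reach each of its `ε`-thickenings. Those are closed and
  -- convex, hence contain the slopes of the approximating flows, then those of `g`, then the
  -- derivative.
  rw [← hcl.closure_eq, Metric.closure_eq_iInter_cthickening]
  refine mem_iInter₂.2 fun ε hε => ?_
  obtain ⟨r, hr, hsub⟩ := Metric.eventually_nhds_iff_ball.1
    (hH.osc_F.eventually_subset_cthickening hH.locallyBounded_F (hgC t ht) hε)
  have hslope := (hasDerivAt_iff_tendsto_slope.1 hd).mono_left
    (nhdsWithin_mono t fun s (hs : s ∈ Ioi t) => ne_of_gt hs)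
  refine Metric.isClosed_cthickening.mem_of_tendsto hslope ?_
  -- Half of `r` covers the motion of `f i` during `[t, s]`, the other half the distance from `f i
  -- t` to `g t`.
  have hsmall : ∀ᶠ s in 𝓝[>] t, (B : ℝ) * (s - t) < r / 2 := by
    refine nhdsWithin_le_nhds (IsOpen.mem_nhds (isOpen_lt (by fun_prop) continuous_const) ?_)
    simpa using hr
  filter_upwards [hsmall, Ioo_mem_nhdsGT ht.2] with s hs hsb
  have hsI : s ∈ Icc a b := ⟨(ht.1.trans hsb.1).le, hsb.2.le⟩
  rw [slope_def_module]
  refine Metric.isClosed_cthickening.mem_of_tendsto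
    (((hlim s hsI).sub (hlim t (Ioo_subset_Icc_self ht))).const_smul (s - t)⁻¹) ?_
  filter_upwards [hlip, hflow, hlim t (Ioo_subset_Icc_self ht) (Metric.ball_mem_nhds _ (half_pos hr))]
    with i hil hif hit
  refine (hif.mono ht.1.le hsb.1.le hsb.2.le).slope_mem hsb.1 Metric.isClosed_cthickening
    ((hH.convex_F _ (hgC t ht)).cthickening ε) fun σ hσ => ?_
  have hσI : σ ∈ Ioo a b := ⟨ht.1.trans hσ.1, hσ.2.trans hsb.2⟩
  refine hsub _ ?_ (hif.mem σ hσI)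
  have h1 := hil.dist_le_mul σ (Ioo_subset_Icc_self hσI) t (Ioo_subset_Icc_self ht)
  rw [Real.dist_eq, abs_of_pos (sub_pos.2 hσ.1)] at h1
  have h2 : (B : ℝ) * (σ - t) ≤ B * (s - t) := by gcongr; exact hσ.2.le
  have h3 := dist_triangle (f i σ) (f i t) (g t)
  have h4 : dist (f i t) (g t) < r / 2 := hit
  exact Metric.mem_ball.2 (by linarith)

end HybridSystem

/-! ### Hybrid time domains -/

/-- An intrinsic form of the notion of hybrid time domain, without the sequence of jump times. -/
structure IsIntrinsicHybridTimeDomain (E : Set (ℝ × ℕ)) : Prop where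
  zero_mem : (0, 0) ∈ E
  nonneg : ∀ t j, (t, j) ∈ E → 0 ≤ t
  ordConnected : ∀ j a b t, (a, j) ∈ E → (b, j) ∈ E → a ≤ t → t ≤ b → (t, j) ∈ E
  exists_jump : ∀ s j, (s, j + 1) ∈ E → ∃ t, (t, j) ∈ E ∧ (t, j + 1) ∈ E
  le_of_succ : ∀ s t j, (s, j) ∈ E → (t, j + 1) ∈ E → s ≤ t

theorem IsHybridTimeDomain.intrinsic {E : Set (ℝ × ℕ)} (h : IsHybridTimeDomain E) :
    IsIntrinsicHybridTimeDomain E := by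
  obtain ⟨t, h0, hm, rfl | ⟨J, L, hL, hLo, rfl⟩⟩ := h
  · refine ⟨⟨h0.le, h0 ▸ hm zero_le_one⟩, fun s j hs => ?_, fun j a b s ha hb has hsb => ?_,
      fun s j hs => ⟨t (j + 1), ⟨hm j.le_succ, le_rfl⟩, le_rfl, hm (j + 1).le_succ⟩,
      fun s u j hs hu => hs.2.trans hu.1⟩
    · exact h0 ▸ (hm (Nat.zero_le j)).trans hs.1
    · exact ⟨ha.1.trans has, hsb.trans hb.2⟩
  · have hlow : ∀ s j, (j < J ∧ t j ≤ s ∧ s ≤ t (j + 1) ∨ j = J ∧ s ∈ L) → t j ≤ s := by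
      rintro s j (h | ⟨rfl, h⟩)
      exacts [h.2.1, hL.2 h]
    have hstart : ∀ j ≤ J, j < J ∧ t j ≤ t j ∧ t j ≤ t (j + 1) ∨ j = J ∧ t j ∈ L := by
      intro j hj
      rcases hj.lt_or_eq with h | rfl
      exacts [Or.inl ⟨h, le_rfl, hm j.le_succ⟩, Or.inr ⟨rfl, hL.1⟩]
    refine ⟨h0 ▸ hstart 0 (Nat.zero_le J), fun s j hs => h0 ▸ (hm (Nat.zero_le j)).trans (hlow s j hs),
      fun j a b s ha hb has hsb => ?_, fun s j hs => ?_, fun s u j hs hu => ?_⟩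
    · rcases ha with ha | ⟨rfl, ha⟩
      · rcases hb with hb | ⟨rfl, hb⟩
        · exact Or.inl ⟨ha.1, ha.2.1.trans has, hsb.trans hb.2.2⟩
        · exact absurd ha.1 (lt_irrefl _)
      · rcases hb with hb | ⟨-, hb⟩
        · exact absurd hb.1 (lt_irrefl _)
        · exact Or.inr ⟨rfl, hLo.out ha hb ⟨has, hsb⟩⟩
    · have hj : j + 1 ≤ J := by
        rcases hs with ⟨h, -⟩ | ⟨h, -⟩ <;> dsimp at h <;> omega
      exact ⟨t (j + 1), Or.inl ⟨hj, hm j.le_succ, le_rfl⟩, hstart (j + 1) hj⟩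
    · have hj : j + 1 ≤ J := by
        rcases hu with ⟨h, -⟩ | ⟨h, -⟩ <;> dsimp at h <;> omega
      rcases hs with h | h
      · exact h.2.2.trans (hlow _ _ hu)
      · exact absurd h.1 (Nat.ne_of_lt hj)

namespace IsIntrinsicHybridTimeDomain

variable {E : Set (ℝ × ℕ)} (h : IsIntrinsicHybridTimeDomain E)
include h

theorem le_of_lt {s t : ℝ} {j k : ℕ} (hs : (s, j) ∈ E) (ht : (t, k) ∈ E) (hjk : j < k) :
    s ≤ t := by
  induction k generalizing t with
  | zero => omega
  | succ k ih =>
    obtain ⟨u, hu, hu'⟩ := h.exists_jump t k ht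
    rcases (Nat.lt_succ_iff.1 hjk).lt_or_eq with hlt | rfl
    · exact (ih hu hlt).trans (h.le_of_succ _ _ _ hu ht)
    · exact h.le_of_succ _ _ _ hs ht

theorem le_total {s t : ℝ} {j k : ℕ} (hs : (s, j) ∈ E) (ht : (t, k) ∈ E) :
    (s ≤ t ∧ j ≤ k) ∨ (t ≤ s ∧ k ≤ j) := by
  rcases lt_trichotomy j k with hlt | rfl | hlt
  · exact Or.inl ⟨h.le_of_lt hs ht hlt, hlt.le⟩
  · exact (_root_.le_total s t).imp (⟨·, le_rfl⟩) (⟨·, le_rfl⟩)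
  · exact Or.inr ⟨h.le_of_lt ht hs hlt, hlt.le⟩

theorem isHybridTimeDomain : IsHybridTimeDomain E := by
  have hex : ∀ j, ∃ u, (∃ s, (s, j + 1) ∈ E) → (u, j) ∈ E ∧ (u, j + 1) ∈ E := fun j => by
    by_cases hj : ∃ s, (s, j + 1) ∈ E
    · obtain ⟨s, hs⟩ := hj
      obtain ⟨u, hu⟩ := h.exists_jump s j hs
      exact ⟨u, fun _ => hu⟩
    · exact ⟨0, fun hj' => absurd hj' hj⟩
  choose τ hτ using hex
  -- `τ j` is the time of the jump from `j` to `j + 1`, so the sequence is `τ` shifted by one with 0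
  -- in front.
  let t : ℕ → ℝ := fun j => Nat.casesOn j 0 τ
  have hdown : ∀ j, (∃ s, (s, j + 1) ∈ E) → ∃ s, (s, j) ∈ E := fun j hj => ⟨_, (hτ j hj).1⟩
  have ht : ∀ j, (∃ s, (s, j) ∈ E) → (t j, j) ∈ E := by
    rintro (_ | j) hj
    exacts [h.zero_mem, (hτ j hj).2]
  have hlow : ∀ s j, (s, j) ∈ E → t j ≤ s := by
    rintro s (_ | j) hs
    exacts [h.nonneg _ _ hs, h.le_of_succ _ _ _ (hτ j ⟨s, hs⟩).1 hs]
  have hmono : ∀ j, (∃ s, (s, j + 1) ∈ E) → t j ≤ t (j + 1) := fun j hj =>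
    hlow _ _ (hτ j hj).1
  have hup : ∀ s j, (∃ u, (u, j + 1) ∈ E) → (s, j) ∈ E → s ≤ t (j + 1) := fun s j hj hs =>
    h.le_of_succ _ _ _ hs (ht _ hj)
  have hmem : ∀ s j, (∃ u, (u, j + 1) ∈ E) → t j ≤ s → s ≤ t (j + 1) → (s, j) ∈ E :=
    fun s j hj hs hs' => h.ordConnected j _ _ s (ht j (hdown j hj)) (hτ j hj).1 hs hs'
  by_cases hall : ∀ j, ∃ s, (s, j) ∈ E
  · refine ⟨t, rfl, monotone_nat_of_le_succ fun j => hmono j (hall _), Or.inl ?_⟩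
    ext ⟨s, j⟩
    exact ⟨fun hs => ⟨hlow _ _ hs, hup _ _ (hall _) hs⟩, fun hs => hmem _ _ (hall _) hs.1 hs.2⟩
  · have hall' : ∃ j, ¬ ∃ s, (s, j) ∈ E := not_forall.1 hall
    classical
    obtain ⟨J, hJ⟩ : ∃ J, Nat.find hall' = J + 1 :=
      Nat.exists_eq_succ_of_ne_zero fun h0 => (h0 ▸ Nat.find_spec hall') ⟨0, h.zero_mem⟩
    have hne : ∀ j ≤ J, ∃ s, (s, j) ∈ E := fun j hj =>
      not_not.1 (Nat.find_min hall' (by omega))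
    have hemp : ∀ j > J, ¬ ∃ s, (s, j) ∈ E := by
      intro j hj
      induction j, hj using Nat.le_induction with
      | base => have := Nat.find_spec hall'; rwa [hJ] at this
      | succ j _ ih => exact fun hc => ih (hdown j hc)
    -- Beyond the last level `J` the chosen times are arbitrary; freezing the sequence at `t J`
    -- keeps it monotone.
    refine ⟨fun j => t (min j J), by simp [t], monotone_nat_of_le_succ fun j => ?_,
      Or.inr ⟨J, {s | (s, J) ∈ E}, ⟨?_, fun s hs => ?_⟩,
        ⟨fun a ha b hb s hs => h.ordConnected J a b s ha hb hs.1 hs.2⟩, ?_⟩⟩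
    · rcases lt_or_ge j J with hj | hj
      · simpa [min_eq_left hj.le, min_eq_left (Nat.succ_le_of_lt hj)] using hmono j (hne _ hj)
      · simp [min_eq_right hj, min_eq_right (hj.trans j.le_succ)]
    · simpa using ht J (hne J le_rfl)
    · simpa using hlow s J hs
    · ext ⟨s, j⟩
      simp only [mem_union, mem_ofPred_eq]
      rcases lt_trichotomy j J with hj | rfl | hj
      · have : ∃ u, (u, j + 1) ∈ E := hne _ hj
        rw [min_eq_left hj.le, min_eq_left (Nat.succ_le_of_lt hj)]
        exact ⟨fun hs => Or.inl ⟨hj, hlow _ _ hs, hup _ _ this hs⟩, fun hs => by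
          rcases hs with hs | hs
          exacts [hmem _ _ this hs.2.1 hs.2.2, absurd hs.1 hj.ne]⟩
      · simp
      · exact ⟨fun hs => absurd ⟨s, hs⟩ (hemp j hj), fun hs => by omega⟩

end IsIntrinsicHybridTimeDomain

theorem HybridArc.dom_intrinsic {n : ℕ} (φ : HybridArc n) : IsIntrinsicHybridTimeDomain φ.dom :=
  φ.isHybridTimeDomain.intrinsic

/-- A property that holds almost everywhere on all compact subintervals of an interval holds almost
everywhere on it. -/
theorem ae_mem_of_forall_Ioo {S : Set ℝ} (hS : S.OrdConnected) {P : ℝ → Prop}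
    (h : ∀ a ∈ S, ∀ b ∈ S, a ≤ b → ∀ᵐ t, t ∈ Ioo a b → P t) : ∀ᵐ t, t ∈ S → P t := by
  -- Rational endpoints leave only countably many exceptional null sets; the frontier of an interval
  -- is null as well.
  have h1 : ∀ᵐ t, ∀ p q : ℚ, (p : ℝ) ∈ S → (q : ℝ) ∈ S → t ∈ Ioo (p : ℝ) q → P t := by
    refine ae_all_iff.2 fun p => ae_all_iff.2 fun q => ?_
    by_cases hpq : (p : ℝ) ∈ S ∧ (q : ℝ) ∈ S ∧ (p : ℝ) ≤ q
    · filter_upwards [h p hpq.1 q hpq.2.1 hpq.2.2] with t ht _ _ hm using ht hm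
    · exact Eventually.of_forall fun t hp hq hm =>
        absurd ⟨hp, hq, (hm.1.trans hm.2).le⟩ hpq
  have h2 : ∀ᵐ t : ℝ, t ∉ frontier S :=
    measure_eq_zero_iff_ae_notMem.1 (hS.convex.addHaar_frontier volume)
  filter_upwards [h1, h2] with t ht hfr htS
  have hint : S ∈ 𝓝 t := mem_interior_iff_mem_nhds.1 (by
    by_contra hc
    exact hfr ⟨subset_closure htS, hc⟩)
  obtain ⟨a, b, hab, hsub⟩ := mem_nhds_iff_exists_Ioo_subset.1 hint
  obtain ⟨p, hp, hp'⟩ := exists_rat_btwn hab.1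
  obtain ⟨q, hq, hq'⟩ := exists_rat_btwn hab.2
  exact ht p q (hsub ⟨hp, hp'.trans hab.2⟩) (hsub ⟨hab.1.trans hq, hq'⟩) ⟨hp', hq⟩

/-! ### Building solutions: concatenation and tails -/

namespace HybridSystem

variable {n : ℕ} {H : HybridSystem n}

theorem IsSolution.isFlow {φ : HybridArc n} (h : H.IsSolution φ) {j : ℕ} {a b : ℝ}
    (ha : (a, j) ∈ φ.dom) (hb : (b, j) ∈ φ.dom) (hab : a ≤ b) :
    H.IsFlow (fun t => φ.toFun t j) a b := by
  rcases hab.eq_or_lt with rfl | hlt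
  · exact IsFlow.refl _ _ _
  have hsub : Icc a b ⊆ φ.flowInterval j := fun t ht =>
    φ.dom_intrinsic.ordConnected j a b t ha hb ht.1 ht.2
  have hint : Ioo a b ⊆ interior (φ.flowInterval j) :=
    interior_maximal (Ioo_subset_Icc_self.trans hsub) isOpen_Ioo
  refine ⟨φ.locallyAbsolutelyContinuous j a b ha hb, fun t ht => h.flow_mem j t (hint ht), ?_⟩
  have := ae_restrict_of_ae_restrict_of_subset (Ioo_subset_Icc_self.trans hsub)
    (h.flow_deriv j ((nonempty_Ioo.2 hlt).mono hint))
  exact (ae_restrict_iff' measurableSet_Ioo).1 this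

/-- The solution with prescribed domain and values. -/
theorem exists_isSolution {E : Set (ℝ × ℕ)} {f : ℝ → ℕ → EucSpace n}
    (hE : IsIntrinsicHybridTimeDomain E) (hinit : f 0 0 ∈ closure H.C ∪ H.D)
    (hflow : ∀ j a b, (a, j) ∈ E → (b, j) ∈ E → a ≤ b → H.IsFlow (fun t => f t j) a b)
    (hjump : ∀ t j, (t, j) ∈ E → (t, j + 1) ∈ E → f t j ∈ H.D ∧ f t (j + 1) ∈ H.G (f t j)) :
    ∃ χ : HybridArc n, H.IsSolution χ ∧ χ.dom = E ∧ χ.toFun = f := by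
  refine ⟨⟨E, f, hE.isHybridTimeDomain, fun j a b ha hb => ?_⟩, ⟨hinit, fun j t ht => ?_,
    fun j _ => ?_, hjump⟩, rfl, rfl⟩
  · rcases le_total a b with h | h
    exacts [(hflow j a b ha hb h).ac, (hflow j b a hb ha h).ac.symm]
  · obtain ⟨a, b, hab, hsub⟩ := mem_nhds_iff_exists_Ioo_subset.1 (mem_interior_iff_mem_nhds.1 ht)
    obtain ⟨p, hp, hp'⟩ := exists_between hab.1
    obtain ⟨q, hq, hq'⟩ := exists_between hab.2
    exact (hflow j p q (hsub ⟨hp, hp'.trans hab.2⟩) (hsub ⟨hab.1.trans hq, hq'⟩)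
      (hp'.trans hq).le).mem t ⟨hp', hq⟩
  · have hoc : {t | (t, j) ∈ E}.OrdConnected :=
      ⟨fun a ha b hb s hs => hE.ordConnected j a b s ha hb hs.1 hs.2⟩
    refine (ae_restrict_iff' hoc.measurableSet).2 (ae_mem_of_forall_Ioo hoc fun a ha b hb hab => ?_)
    exact (hflow j a b ha hb hab).ae_deriv

/-- Concatenation of the truncation of a solution at `(b, J)` with a solution that starts at the
point reached there. -/
theorem IsSolution.exists_concat {φ ψ : HybridArc n} (hC : IsClosed H.C) (hφ : H.IsSolution φ)
    (hψ : H.IsSolution ψ) {b : ℝ} {J : ℕ} (hb : (b, J) ∈ φ.dom)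
    (h0 : ψ.toFun 0 0 = φ.toFun b J) :
    ∃ χ : HybridArc n, H.IsSolution χ ∧
      (∀ t j, (t, j) ∈ χ.dom ↔
        ((t, j) ∈ φ.dom ∧ t ≤ b ∧ j ≤ J) ∨ (J ≤ j ∧ (t - b, j - J) ∈ ψ.dom)) ∧
      (∀ t j, (t, j) ∈ φ.dom → t ≤ b → j ≤ J → χ.toFun t j = φ.toFun t j) ∧
      ∀ t j, (t, j) ∈ ψ.dom → χ.toFun (t + b) (j + J) = ψ.toFun t j := by
  classical
  have aφ := φ.dom_intrinsic
  have aψ := ψ.dom_intrinsic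
  let f : ℝ → ℕ → EucSpace n := fun t j =>
    if t ≤ b ∧ j ≤ J then φ.toFun t j else ψ.toFun (t - b) (j - J)
  have f1 : ∀ t j, t ≤ b → j ≤ J → f t j = φ.toFun t j := fun t j ht hj => if_pos ⟨ht, hj⟩
  -- The two pieces overlap only at `(b, J)`, where `h0` makes them agree.
  have f2 : ∀ t j, J ≤ j → (t - b, j - J) ∈ ψ.dom → f t j = ψ.toFun (t - b) (j - J) := by
    intro t j hj hd
    by_cases hc : t ≤ b ∧ j ≤ J
    · have ht : t = b := le_antisymm hc.1 (sub_nonneg.1 (aψ.nonneg _ _ hd))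
      obtain rfl : j = J := le_antisymm hc.2 hj
      subst ht
      rw [f1 _ _ le_rfl le_rfl, sub_self, Nat.sub_self, h0]
    · exact if_neg hc
  let E : Set (ℝ × ℕ) := {p | ((p.1, p.2) ∈ φ.dom ∧ p.1 ≤ b ∧ p.2 ≤ J) ∨
    (J ≤ p.2 ∧ (p.1 - b, p.2 - J) ∈ ψ.dom)}
  have hbψ : (b - b, J - J) ∈ ψ.dom := by simpa using aψ.zero_mem
  have hE : IsIntrinsicHybridTimeDomain E := by
    refine ⟨Or.inl ⟨aφ.zero_mem, aφ.nonneg _ _ hb, Nat.zero_le J⟩, ?_, ?_, ?_, ?_⟩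
    · rintro t j (h | h)
      · exact aφ.nonneg _ _ h.1
      · have := aψ.nonneg _ _ h.2
        have := aφ.nonneg _ _ hb
        dsimp at *
        linarith
    · rintro j u v t (hu | hu) (hv | hv) hut htv
      · exact Or.inl ⟨aφ.ordConnected j u v t hu.1 hv.1 hut htv, htv.trans hv.2.1, hv.2.2⟩
      · obtain rfl : j = J := le_antisymm hu.2.2 hv.1
        rcases le_total t b with h | h
        · exact Or.inl ⟨aφ.ordConnected j u b t hu.1 hb hut h, h, le_rfl⟩
        · exact Or.inr ⟨le_rfl, aψ.ordConnected _ _ _ _ hbψ hv.2 (by linarith)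
            (by dsimp; linarith)⟩
      · have h1 := aψ.nonneg _ _ hu.2
        have h2 := hv.2.1
        dsimp at *
        obtain rfl : t = u := by linarith
        exact Or.inr hu
      · exact Or.inr ⟨hu.1, aψ.ordConnected _ _ _ _ hu.2 hv.2 (by dsimp; linarith)
          (by dsimp; linarith)⟩
    · rintro s j (hs | hs)
      · obtain ⟨t, ht, ht'⟩ := aφ.exists_jump s j hs.1
        have := (aφ.le_of_succ t s j ht hs.1).trans hs.2.1
        exact ⟨t, Or.inl ⟨ht, this, (Nat.le_succ j).trans hs.2.2⟩, Or.inl ⟨ht', this, hs.2.2⟩⟩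
      · rcases Nat.lt_or_ge j J with hj | hj
        · obtain rfl : j + 1 = J := le_antisymm hj hs.1
          obtain ⟨t, ht, ht'⟩ := aφ.exists_jump b j hb
          have := aφ.le_of_succ t b j ht hb
          exact ⟨t, Or.inl ⟨ht, this, Nat.le_succ j⟩, Or.inl ⟨ht', this, le_rfl⟩⟩
        · have h2 := hs.2
          simp only [Nat.succ_sub hj] at h2
          obtain ⟨t, ht, ht'⟩ := aψ.exists_jump _ _ h2
          refine ⟨t + b, Or.inr ⟨hj, by simpa using ht⟩, Or.inr ⟨hs.1, ?_⟩⟩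
          simpa [Nat.succ_sub hj] using ht'
    · rintro s t j (hs | hs) (ht | ht)
      · exact aφ.le_of_succ s t j hs.1 ht.1
      · have := aψ.nonneg _ _ ht.2
        have := hs.2.1
        dsimp at *
        linarith
      · exact absurd (hs.1.trans_lt (Nat.lt_succ_self j)) (not_lt.2 ht.2.2)
      · have h2 := ht.2
        simp only [Nat.succ_sub hs.1] at h2
        have := aψ.le_of_succ _ _ _ hs.2 h2
        dsimp at this
        linarith
  have flow1 : ∀ j u v, (u, j) ∈ φ.dom → (v, j) ∈ φ.dom → u ≤ v → v ≤ b → j ≤ J →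
      H.IsFlow (fun t => f t j) u v := fun j u v hu hv huv hvb hj =>
    (hφ.isFlow hu hv huv).congr huv fun t ht => (f1 t j (ht.2.trans hvb) hj).symm
  have flow2 : ∀ j u v, J ≤ j → (u - b, j - J) ∈ ψ.dom → (v - b, j - J) ∈ ψ.dom → u ≤ v →
      H.IsFlow (fun t => f t j) u v := fun j u v hj hu hv huv =>
    ((hψ.isFlow hu hv (by linarith)).comp_sub_const b).congr huv fun t ht =>
      (f2 t j hj (aψ.ordConnected _ _ _ _ hu hv (by linarith [ht.1]) (by linarith [ht.2]))).symm
  have key : ∃ χ : HybridArc n, H.IsSolution χ ∧ χ.dom = E ∧ χ.toFun = f := by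
    refine exists_isSolution hE ?_ ?_ ?_
    · rw [f1 0 0 (aφ.nonneg _ _ hb) (Nat.zero_le J)]
      exact hφ.init
    · rintro j u v (hu | hu) (hv | hv) huv
      · exact flow1 j u v hu.1 hv.1 huv hv.2.1 hu.2.2
      · obtain rfl : j = J := le_antisymm hu.2.2 hv.1
        have := aψ.nonneg _ _ hv.2
        exact (flow1 j u b hu.1 hb hu.2.1 le_rfl le_rfl).trans hC hu.2.1 (by dsimp at this; linarith)
          (flow2 j b v le_rfl hbψ hv.2 (by dsimp at this; linarith))
      · have h1 := aψ.nonneg _ _ hu.2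
        have h2 := hv.2.1
        dsimp at *
        obtain rfl : u = v := by linarith
        exact IsFlow.refl _ _ _
      · exact flow2 j u v hu.1 hu.2 hv.2 huv
    · rintro t j (ht | ht) (ht' | ht')
      · rw [f1 t j ht.2.1 ht.2.2, f1 t (j + 1) ht.2.1 ht'.2.2]
        exact hφ.jump t j ht.1 ht'.1
      · rcases Nat.lt_or_ge j J with hj | hj
        · obtain rfl : j + 1 = J := le_antisymm hj ht'.1
          have h1 := aψ.nonneg _ _ ht'.2
          have h2 := ht.2.1
          dsimp at *
          obtain rfl : t = b := by linarith
          rw [f1 t j le_rfl (Nat.le_succ j), f1 t (j + 1) le_rfl le_rfl]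
          exact hφ.jump t j ht.1 hb
        · obtain rfl : j = J := le_antisymm ht.2.2 hj
          have h1 := aψ.nonneg _ _ ht'.2
          have h2 := ht.2.1
          dsimp at *
          obtain rfl : t = b := by linarith
          have h3 := ht'.2
          rw [f2 t j le_rfl hbψ, f2 t (j + 1) (Nat.le_succ j) h3]
          simp only [Nat.succ_sub (le_refl j)] at h3 ⊢
          exact hψ.jump _ _ hbψ h3
      · exact absurd (ht.1.trans_lt (Nat.lt_succ_self j)) (not_lt.2 ht'.2.2)
      · have h3 := ht'.2
        rw [f2 t j ht.1 ht.2, f2 t (j + 1) ht'.1 h3]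
        simp only [Nat.succ_sub ht.1] at h3 ⊢
        exact hψ.jump _ _ ht.2 h3
  obtain ⟨χ, hχ, rfl', hf⟩ := key
  refine ⟨χ, hχ, fun t j => rfl' ▸ Iff.rfl, fun t j _ ht hj => hf ▸ f1 t j ht hj,
    fun t j hd => ?_⟩
  rw [hf, f2 _ _ (Nat.le_add_left J j) (by simpa using hd)]
  simp

/-- The tail of a solution. -/
theorem IsSolution.exists_tail {φ : HybridArc n} (hφ : H.IsSolution φ) {b : ℝ} {J : ℕ}
    (hb : (b, J) ∈ φ.dom) (hinit : φ.toFun b J ∈ closure H.C ∪ H.D) :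
    ∃ χ : HybridArc n, H.IsSolution χ ∧
      (∀ t j, (t, j) ∈ χ.dom ↔ 0 ≤ t ∧ (t + b, j + J) ∈ φ.dom) ∧
      ∀ t j, χ.toFun t j = φ.toFun (t + b) (j + J) := by
  have a := φ.dom_intrinsic
  have key : ∃ χ : HybridArc n, H.IsSolution χ ∧
      χ.dom = {p | 0 ≤ p.1 ∧ (p.1 + b, p.2 + J) ∈ φ.dom} ∧
      χ.toFun = fun t j => φ.toFun (t + b) (j + J) := by
    refine exists_isSolution ⟨by simpa using hb, fun t j h => h.1,
      fun j u v t hu hv hut htv => ⟨hu.1.trans hut, a.ordConnected _ _ _ _ hu.2 hv.2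
        (by dsimp; linarith) (by dsimp; linarith)⟩, fun s j hs => ?_, fun s t j hs ht => ?_⟩
      (by simpa using hinit) (fun j u v hu hv huv => ?_) (fun t j ht ht' => ?_)
    · have h2 := hs.2
      simp only [Nat.add_right_comm j 1 J] at h2
      obtain ⟨t, ht, ht'⟩ := a.exists_jump _ _ h2
      rcases le_total b t with h | h
      · refine ⟨t - b, ⟨sub_nonneg.2 h, by simpa using ht⟩, sub_nonneg.2 h, ?_⟩
        simpa [Nat.add_right_comm j 1 J] using ht'
      · have h3 := a.le_of_lt hb ht' (by omega)
        obtain rfl := le_antisymm h h3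
        exact ⟨0, ⟨le_rfl, by simpa using ht⟩, le_rfl, by simpa [Nat.add_right_comm j 1 J] using ht'⟩
    · have h2 := ht.2
      simp only [Nat.add_right_comm j 1 J] at h2
      have := a.le_of_succ _ _ _ hs.2 h2
      dsimp at this
      linarith
    · have := (hφ.isFlow hu.2 hv.2 (by dsimp; linarith))
      simpa using IsFlow.comp_sub_const (-b) (by simpa using this)
    · have h2 := ht'.2
      simp only [Nat.add_right_comm j 1 J] at h2 ⊢
      exact hφ.jump _ _ ht.2 h2
  obtain ⟨χ, hχ, hE, hf⟩ := key
  exact ⟨χ, hχ, fun t j => hE ▸ Iff.rfl, fun t j => hf ▸ rfl⟩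

end HybridSystem

/-! ### Chains and maximal extensions -/

/-- `ψ` extends `φ`. -/
def HybridArc.Extends {n : ℕ} (ψ φ : HybridArc n) : Prop :=
  φ.dom ⊆ ψ.dom ∧ ∀ t j, (t, j) ∈ φ.dom → φ.toFun t j = ψ.toFun t j

namespace HybridSystem

variable {n : ℕ} {H : HybridSystem n}

/-- The union of a chain of solutions. -/
theorem exists_isSolution_of_chain {c : Set (HybridArc n)} (hc : ∀ φ ∈ c, H.IsSolution φ)
    (hchain : ∀ φ ∈ c, ∀ ψ ∈ c, ψ.Extends φ ∨ φ.Extends ψ) (hne : c.Nonempty) :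
    ∃ χ : HybridArc n, H.IsSolution χ ∧ χ.dom = ⋃ φ ∈ c, φ.dom ∧ ∀ φ ∈ c, χ.Extends φ := by
  classical
  let E : Set (ℝ × ℕ) := ⋃ φ ∈ c, φ.dom
  have hE : ∀ p : ℝ × ℕ, p ∈ E ↔ ∃ φ ∈ c, p ∈ φ.dom := fun p => by simp [E]
  let f : ℝ → ℕ → EucSpace n := fun t j =>
    if h : ∃ φ ∈ c, (t, j) ∈ φ.dom then h.choose.toFun t j else 0
  have hf : ∀ φ ∈ c, ∀ t j, (t, j) ∈ φ.dom → φ.toFun t j = f t j := by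
    intro φ hφ t j h
    have hex : ∃ φ ∈ c, (t, j) ∈ φ.dom := ⟨φ, hφ, h⟩
    simp only [f, dif_pos hex]
    obtain ⟨h1, h2⟩ := hex.choose_spec
    rcases hchain φ hφ _ h1 with h' | h'
    exacts [h'.2 t j h, (h'.2 t j h2).symm]
  have hdir : ∀ p q : ℝ × ℕ, p ∈ E → q ∈ E → ∃ φ ∈ c, p ∈ φ.dom ∧ q ∈ φ.dom := by
    intro p q hp hq
    obtain ⟨φ, hφ, hp⟩ := (hE p).1 hp
    obtain ⟨ψ, hψ, hq⟩ := (hE q).1 hq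
    rcases hchain φ hφ ψ hψ with h' | h'
    exacts [⟨ψ, hψ, h'.1 hp, hq⟩, ⟨φ, hφ, hp, h'.1 hq⟩]
  obtain ⟨φ₀, hφ₀⟩ := hne
  have key : ∃ χ : HybridArc n, H.IsSolution χ ∧ χ.dom = E ∧ χ.toFun = f := by
    refine exists_isSolution
      ⟨(hE _).2 ⟨φ₀, hφ₀, φ₀.dom_intrinsic.zero_mem⟩, fun t j h => ?_, fun j a b t ha hb hat htb => ?_,
      fun s j hs => ?_, fun s t j hs ht => ?_⟩ ?_ (fun j a b ha hb hab => ?_)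
      (fun t j ht ht' => ?_)
    · obtain ⟨φ, -, h⟩ := (hE _).1 h
      exact φ.dom_intrinsic.nonneg _ _ h
    · obtain ⟨φ, hφ, ha, hb⟩ := hdir _ _ ha hb
      exact (hE _).2 ⟨φ, hφ, φ.dom_intrinsic.ordConnected j a b t ha hb hat htb⟩
    · obtain ⟨φ, hφ, h⟩ := (hE _).1 hs
      obtain ⟨t, ht, ht'⟩ := φ.dom_intrinsic.exists_jump s j h
      exact ⟨t, (hE _).2 ⟨φ, hφ, ht⟩, (hE _).2 ⟨φ, hφ, ht'⟩⟩
    · obtain ⟨φ, -, hs, ht⟩ := hdir _ _ hs ht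
      exact φ.dom_intrinsic.le_of_succ s t j hs ht
    · rw [← hf φ₀ hφ₀ 0 0 φ₀.dom_intrinsic.zero_mem]
      exact (hc φ₀ hφ₀).init
    · obtain ⟨φ, hφ, ha, hb⟩ := hdir _ _ ha hb
      exact ((hc φ hφ).isFlow ha hb hab).congr hab fun t ht =>
        hf φ hφ t j (φ.dom_intrinsic.ordConnected j a b t ha hb ht.1 ht.2)
    · obtain ⟨φ, hφ, ht, ht'⟩ := hdir _ _ ht ht'
      rw [← hf φ hφ t j ht, ← hf φ hφ t (j + 1) ht']
      exact (hc φ hφ).jump t j ht ht'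
  obtain ⟨χ, hχ, hχE, hχf⟩ := key
  refine ⟨χ, hχ, hχE, fun φ hφ => ⟨?_, fun t j h => hχf ▸ hf φ hφ t j h⟩⟩
  rw [hχE]
  exact fun p hp => (hE p).2 ⟨φ, hφ, hp⟩

/-- Every solution with values in `S` extends to a maximal one among those. -/
theorem IsSolution.exists_maximal_extension {φ : HybridArc n} (hφ : H.IsSolution φ)
    {S : Set (EucSpace n)} (hS : φ.rge ⊆ S) :
    ∃ ψ : HybridArc n, H.IsSolution ψ ∧ ψ.rge ⊆ S ∧ ψ.Extends φ ∧
      ∀ χ : HybridArc n, H.IsSolution χ → χ.rge ⊆ S → χ.Extends ψ → χ.dom ⊆ ψ.dom := by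
  let T := {ψ : HybridArc n // H.IsSolution ψ ∧ ψ.rge ⊆ S ∧ ψ.Extends φ}
  have htrans : ∀ {a b c : HybridArc n}, b.Extends a → c.Extends b → c.Extends a :=
    fun hab hbc => ⟨hab.1.trans hbc.1, fun t j h => (hab.2 t j h).trans (hbc.2 t j (hab.1 h))⟩
  have hrefl : ∀ a : HybridArc n, a.Extends a := fun a => ⟨subset_rfl, fun _ _ _ => rfl⟩
  have : Nonempty T := ⟨⟨φ, hφ, hS, hrefl φ⟩⟩
  have key : ∃ m : T, ∀ a : T, a.1.Extends m.1 → m.1.Extends a.1 := by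
    refine exists_maximal_of_nonempty_chains_bounded (r := fun a b : T => b.1.Extends a.1)
      (fun c hc hne => ?_) htrans
    · obtain ⟨χ, hχ, hdom, hext⟩ := exists_isSolution_of_chain (H := H) (c := Subtype.val '' c)
        (by rintro _ ⟨a, -, rfl⟩; exact a.2.1)
        (by
          rintro _ ⟨a, ha, rfl⟩ _ ⟨b, hb, rfl⟩
          by_cases hab : a = b
          · exact Or.inl (hab ▸ hrefl _)
          · exact hc ha hb hab) (hne.image _)
      refine ⟨⟨χ, hχ, ?_, ?_⟩, fun a ha => hext _ (mem_image_of_mem _ ha)⟩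
      · rintro _ ⟨t, j, hd, rfl⟩
        rw [hdom] at hd
        obtain ⟨_, ⟨a, ha, rfl⟩, hd⟩ := mem_iUnion₂.1 hd
        rw [← (hext a.1 (mem_image_of_mem _ ha)).2 t j hd]
        exact a.2.2.1 ⟨t, j, hd, rfl⟩
      · obtain ⟨a, ha⟩ := hne
        exact htrans a.2.2.2 (hext a.1 (mem_image_of_mem _ ha))
  obtain ⟨m, hm⟩ := key
  refine ⟨m.1, m.2.1, m.2.2.1, m.2.2.2, fun χ hχ hχS hχm => ?_⟩
  exact (hm ⟨χ, hχ, hχS, htrans m.2.2.2 hχm⟩ hχm).1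

end HybridSystem

theorem HybridArc.Extends.rge_subset {n : ℕ} {ψ φ : HybridArc n} (h : ψ.Extends φ) :
    φ.rge ⊆ ψ.rge := by
  rintro _ ⟨t, j, hd, rfl⟩
  exact ⟨t, j, h.1 hd, (h.2 t j hd).symm⟩

/-! ### The basin with safety -/

/-- `φ` is bounded, avoids `U`, and converges to `A` if it is complete. -/
structure HybridArc.IsSafelyAttracted {n : ℕ} (φ : HybridArc n) (U A : Set (EucSpace n)) :
    Prop where
  isBounded : Bornology.IsBounded φ.rge
  convergesTo : φ.IsComplete → φ.ConvergesTo A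
  disjoint : ∀ t j, (t, j) ∈ φ.dom → φ.toFun t j ∉ U

namespace HybridSystem

variable {n : ℕ} {H : HybridSystem n} {U A : Set (EucSpace n)}

/-- Safety is defined through maximal solutions. A maximal extension has a larger range, so avoiding
`U` passes down to every solution. -/
theorem mem_safeBasin_iff {x : EucSpace n} : x ∈ H.safeBasin U A ↔
    ∀ φ : HybridArc n, H.IsSolution φ → φ.toFun 0 0 = x → φ.IsSafelyAttracted U A := by
  refine ⟨fun hx φ hφ h0 => ⟨(hx.1 φ hφ h0).1, (hx.1 φ hφ h0).2, fun t j hd hU => ?_⟩,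
    fun h => ⟨fun φ hφ h0 => ⟨(h φ hφ h0).isBounded, (h φ hφ h0).convergesTo⟩, fun φ hφ => ?_⟩⟩
  · obtain ⟨ψ, hψ, -, hext, hmax⟩ := hφ.exists_maximal_extension (subset_univ _)
    have hψ0 : ψ.toFun 0 0 = x := (hext.2 0 0 φ.dom_intrinsic.zero_mem).symm.trans h0
    have hψm : H.IsMaximalSolution ψ :=
      ⟨hψ, fun ⟨χ, hχ, hss, hag⟩ => hss.2 (hmax χ hχ (subset_univ _) ⟨hss.1, hag⟩)⟩
    exact (hx.2 ψ ⟨hψm, hψ0⟩).subset ⟨hext.rge_subset ⟨t, j, hd, rfl⟩, hU⟩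
  · refine eq_empty_of_forall_notMem ?_
    rintro _ ⟨⟨t, j, hd, rfl⟩, hU⟩
    exact (h φ hφ.1.1 hφ.2).disjoint t j hd hU

/-- Points reached from the basin with safety are in the basin with safety and outside `U`. -/
theorem IsSolution.mem_safeBasin_diff {φ : HybridArc n} (hC : IsClosed H.C) (hφ : H.IsSolution φ)
    (h0 : φ.toFun 0 0 ∈ H.safeBasin U A) {b : ℝ} {J : ℕ} (hb : (b, J) ∈ φ.dom) :
    φ.toFun b J ∈ H.safeBasin U A \ U := by
  refine ⟨mem_safeBasin_iff.2 fun ψ hψ hψ0 => ?_,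
    (mem_safeBasin_iff.1 h0 φ hφ rfl).disjoint b J hb⟩
  obtain ⟨χ, hχ, hdom, hχ1, hχ2⟩ := hφ.exists_concat hC hψ hb hψ0
  have hχ0 : χ.toFun 0 0 = φ.toFun 0 0 :=
    hχ1 0 0 φ.dom_intrinsic.zero_mem (φ.dom_intrinsic.nonneg _ _ hb) (Nat.zero_le J)
  have hmem : ∀ t j, (t, j) ∈ ψ.dom → (t + b, j + J) ∈ χ.dom := fun t j hd =>
    (hdom _ _).2 (Or.inr ⟨Nat.le_add_left J j, by simpa using hd⟩)
  have hb0 := φ.dom_intrinsic.nonneg _ _ hb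
  have hsafe := mem_safeBasin_iff.1 h0 χ hχ hχ0
  refine ⟨hsafe.isBounded.subset ?_, fun hc ε hε => ?_, fun t j hd => ?_⟩
  · rintro _ ⟨t, j, hd, rfl⟩
    exact ⟨t + b, j + J, hmem t j hd, hχ2 t j hd⟩
  · obtain ⟨T, hT⟩ := hsafe.convergesTo (fun T => by
      obtain ⟨t, j, hd, hle⟩ := hc T
      refine ⟨t + b, j + J, hmem t j hd, ?_⟩
      push_cast
      linarith [(Nat.cast_nonneg J : (0 : ℝ) ≤ J)]) ε hε
    refine ⟨T, fun t j hd hle => ?_⟩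
    rw [← hχ2 t j hd]
    refine hT _ _ (hmem t j hd) ?_
    push_cast
    linarith [(Nat.cast_nonneg J : (0 : ℝ) ≤ J)]
  · rw [← hχ2 t j hd]
    exact hsafe.disjoint _ _ (hmem t j hd)

theorem forwardPreInvariant_safeBasin (hC : IsClosed H.C) :
    H.ForwardPreInvariant (H.safeBasin U A) := by
  rintro φ ⟨hφ, h0⟩ _ ⟨t, j, hd, rfl⟩
  exact (hφ.1.mem_safeBasin_diff hC h0 hd).1

/-- A pre-asymptotically stable compact set has a neighborhood in its basin with safety. -/
theorem UpAS.exists_thickening_subset (hA : IsCompact A) (hU : IsClosed U) (hAU : A ∩ U = ∅)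
    (h : H.UpAS A) : ∃ ε > 0, Metric.thickening ε A ⊆ H.safeBasin U A \ U := by
  obtain ⟨-, hst, ρ, hρ, hatt⟩ := h
  obtain ⟨δ, hδ, hδU⟩ := hA.exists_thickening_subset_open hU.isOpen_compl
    (disjoint_iff_inter_eq_empty.2 hAU).subset_compl_right
  obtain ⟨η, hη, hst⟩ := hst δ hδ
  -- `δ` keeps the points off `U`, `η` keeps solutions in the `δ`-thickening, and `ρ` gives
  -- attraction.
  refine ⟨min δ (min η ρ), by positivity, fun x hx => ⟨?_, ?_⟩⟩
  · refine mem_safeBasin_iff.2 fun φ hφ h0 => ?_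
    have hx' : Metric.infEDist (φ.toFun 0 0) A < ENNReal.ofReal (min δ (min η ρ)) := h0 ▸ hx
    have hin : ∀ t j, (t, j) ∈ φ.dom → φ.toFun t j ∈ Metric.thickening δ A :=
      hst φ hφ (hx'.trans_le (ENNReal.ofReal_le_ofReal (by simp)))
    refine ⟨(hA.isBounded.thickening (δ := δ)).subset ?_, fun _ ε hε => ?_,
      fun t j hd => hδU (hin t j hd)⟩
    · rintro _ ⟨t, j, hd, rfl⟩
      exact hin t j hd
    · obtain ⟨T, -, hT⟩ := hatt ε hε
      exact ⟨T, hT φ hφ (hx'.trans_le (ENNReal.ofReal_le_ofReal (by simp)))⟩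
  · exact hδU (Metric.thickening_mono (min_le_left _ _) _ hx)

/-- A solution that is not safely attracted still is not so after a bounded safe initial part. -/
theorem IsSolution.notMem_safeBasin_diff {φ : HybridArc n} (hC : IsClosed H.C)
    (hφ : H.IsSolution φ) (hbad : ¬ φ.IsSafelyAttracted U A) {b : ℝ} {J : ℕ}
    (hb : (b, J) ∈ φ.dom) {S : Set (EucSpace n)} (hS : Bornology.IsBounded S)
    (hSU : Disjoint S U) (hin : ∀ t j, (t, j) ∈ φ.dom → t ≤ b → j ≤ J →
      φ.toFun t j ∈ S ∨ φ.toFun t j = φ.toFun b J) :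
    φ.toFun b J ∉ H.safeBasin U A \ U := by
  rintro ⟨hsafe, hU⟩
  apply hbad
  have a := φ.dom_intrinsic
  have hinU : ∀ t j, (t, j) ∈ φ.dom → t ≤ b → j ≤ J → φ.toFun t j ∉ U := fun t j hd ht hj => by
    rcases hin t j hd ht hj with h | h
    exacts [disjoint_left.1 hSU h, h ▸ hU]
  have hSb : Bornology.IsBounded (S ∪ {φ.toFun b J}) := hS.union Bornology.isBounded_singleton
  -- A jump may land outside `closure C ∪ D`, where no solution starts. There is then no tail to
  -- test, but `φ` must end at that point, and `φ.toFun b J ∉ U` settles safety. This is why `U` is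
  -- removed from the basin.
  by_cases hinit : φ.toFun b J ∈ closure H.C ∪ H.D
  · obtain ⟨χ, hχ, hdom, hval⟩ := hφ.exists_tail hb hinit
    have hχs := mem_safeBasin_iff.1 hsafe χ hχ (by simp [hval])
    have hlate : ∀ t j, (t, j) ∈ φ.dom → b ≤ t → J ≤ j →
        (t - b, j - J) ∈ χ.dom ∧ χ.toFun (t - b) (j - J) = φ.toFun t j := fun t j hd ht hj =>
      ⟨(hdom _ _).2 ⟨sub_nonneg.2 ht, by simpa [Nat.sub_add_cancel hj] using hd⟩,
        by simp [hval, Nat.sub_add_cancel hj]⟩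
    refine ⟨(hSb.union hχs.isBounded).subset ?_, fun hc ε hε => ?_, fun t j hd => ?_⟩
    · rintro _ ⟨t, j, hd, rfl⟩
      rcases a.le_total hd hb with h | h
      · exact Or.inl (hin t j hd h.1 h.2)
      · obtain ⟨h1, h2⟩ := hlate t j hd h.1 h.2
        exact Or.inr ⟨_, _, h1, h2⟩
    · obtain ⟨T, hT⟩ := hχs.convergesTo (fun T => by
        -- The term `b + J + 1` excludes points of the initial part; the other absorbs the time
        -- shift.
        obtain ⟨t, j, hd, hle⟩ := hc (max (T + b + J) (b + J + 1))
        obtain ⟨hle1, hle2⟩ := max_le_iff.1 hle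
        rcases a.le_total hd hb with h | h
        · have : (j : ℝ) ≤ J := by exact_mod_cast h.2
          linarith [h.1]
        · refine ⟨_, _, (hlate t j hd h.1 h.2).1, ?_⟩
          rw [Nat.cast_sub h.2]
          linarith) ε hε
      refine ⟨max (T + b + J) (b + J + 1), fun t j hd hle => ?_⟩
      obtain ⟨hle1, hle2⟩ := max_le_iff.1 hle
      rcases a.le_total hd hb with h | h
      · have : (j : ℝ) ≤ J := by exact_mod_cast h.2
        linarith [h.1]
      · obtain ⟨h1, h2⟩ := hlate t j hd h.1 h.2
        rw [← h2]
        refine hT _ _ h1 ?_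
        rw [Nat.cast_sub h.2]
        linarith
    · rcases a.le_total hd hb with h | h
      · exact hinU t j hd h.1 h.2
      · obtain ⟨h1, h2⟩ := hlate t j hd h.1 h.2
        exact h2 ▸ hχs.disjoint _ _ h1
  · have hall : ∀ t j, (t, j) ∈ φ.dom → t ≤ b ∧ j ≤ J := by
      intro t j hd
      by_contra hc
      apply hinit
      have hle : b ≤ t ∧ J ≤ j := (a.le_total hd hb).resolve_left hc
      have hflow : ∀ u, (u, J) ∈ φ.dom → b < u → φ.toFun b J ∈ closure H.C ∪ H.D :=
        fun u hu hbu => Or.inl (subset_closure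
          ((hφ.isFlow hb hu hbu.le).mem_Icc hC hbu b ⟨le_rfl, hbu.le⟩))
      rcases hle.2.eq_or_lt with rfl | hlt
      · exact hflow t hd (lt_of_le_of_ne hle.1 fun h => hc ⟨h.ge, le_rfl⟩)
      · have hex : ∀ k, J + 1 ≤ k → (∃ s, (s, k) ∈ φ.dom) → ∃ s, (s, J + 1) ∈ φ.dom := by
          intro k hk
          induction k, hk using Nat.le_induction with
          | base => exact id
          | succ k _ ih => exact fun ⟨s, hs⟩ => ih ((a.exists_jump s k hs).imp fun _ h => h.1)
        obtain ⟨s, hs⟩ := hex j hlt ⟨t, hd⟩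
        obtain ⟨u, hu, hu'⟩ := a.exists_jump s J hs
        rcases (a.le_of_succ b u J hb hu').eq_or_lt with rfl | hbu
        · exact Or.inr (hφ.jump _ _ hb hu').1
        · exact hflow u hu hbu
    refine ⟨hSb.subset ?_, fun hc => ?_, fun t j hd => hinU t j hd (hall t j hd).1 (hall t j hd).2⟩
    · rintro _ ⟨t, j, hd, rfl⟩
      exact hin t j hd (hall t j hd).1 (hall t j hd).2
    · obtain ⟨t, j, hd, hle⟩ := hc (b + J + 1)
      have : (j : ℝ) ≤ J := by exact_mod_cast (hall t j hd).2
      linarith [(hall t j hd).1]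

/-- A flow on `[0, τ]` as a solution. -/
theorem IsFlow.exists_isSolution {f : ℝ → EucSpace n} {τ : ℝ} (hτ : 0 ≤ τ)
    (hinit : f 0 ∈ closure H.C ∪ H.D) (hf : H.IsFlow f 0 τ) :
    ∃ χ : HybridArc n, H.IsSolution χ ∧ (∀ t j, (t, j) ∈ χ.dom ↔ j = 0 ∧ 0 ≤ t ∧ t ≤ τ) ∧
      ∀ t, χ.toFun t 0 = f t := by
  have key : ∃ χ : HybridArc n, H.IsSolution χ ∧ χ.dom = {p | p.2 = 0 ∧ 0 ≤ p.1 ∧ p.1 ≤ τ} ∧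
      χ.toFun = fun t _ => f t := by
    refine HybridSystem.exists_isSolution ⟨⟨rfl, le_rfl, hτ⟩, fun t j h => h.2.1,
      fun j a b t ha hb hat htb => ⟨ha.1, ha.2.1.trans hat, htb.trans hb.2.2⟩,
      fun s j hs => absurd hs.1 j.succ_ne_zero, fun s t j _ ht => absurd ht.1 j.succ_ne_zero⟩
      hinit (fun j a b ha hb hab => hf.mono ha.2.1 hab hb.2.2)
      (fun t j _ ht => absurd ht.1 j.succ_ne_zero)
  obtain ⟨χ, hχ, hE, hfun⟩ := key
  exact ⟨χ, hχ, fun t j => hE ▸ Iff.rfl, fun t => hfun ▸ rfl⟩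

/-- A single jump as a solution. -/
theorem exists_isSolution_of_jump {z w : EucSpace n} (hz : z ∈ H.D) (hw : w ∈ H.G z) :
    ∃ χ : HybridArc n, H.IsSolution χ ∧ (∀ t j, (t, j) ∈ χ.dom ↔ t = 0 ∧ j ≤ 1) ∧
      χ.toFun 0 0 = z ∧ χ.toFun 0 1 = w := by
  have key : ∃ χ : HybridArc n, H.IsSolution χ ∧ χ.dom = {p | p.1 = 0 ∧ p.2 ≤ 1} ∧
      χ.toFun = fun _ j => if j = 0 then z else w := by
    refine HybridSystem.exists_isSolution ⟨⟨rfl, Nat.zero_le 1⟩, fun t j h => h.1.ge,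
      fun j a b t ha hb hat htb => ⟨le_antisymm (htb.trans hb.1.le) (ha.1.ge.trans hat), ha.2⟩,
      fun s j hs => ⟨0, ⟨rfl, (Nat.le_succ j).trans hs.2⟩, rfl, hs.2⟩,
      fun s t j hs ht => hs.1.le.trans ht.1.ge⟩ (Or.inr (by simpa using hz))
      (fun j a b ha hb _ => ?_) (fun t j _ ht => ?_)
    · obtain rfl : a = b := ha.1.trans hb.1.symm
      exact IsFlow.refl _ _ _
    · obtain rfl : j = 0 := by have := ht.2; dsimp at this; omega
      simpa using ⟨hz, hw⟩
  obtain ⟨χ, hχ, hE, hfun⟩ := key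
  exact ⟨χ, hχ, fun t j => hE ▸ Iff.rfl, by simp [hfun], by simp [hfun]⟩

/-- A flow cannot leave a ball on which it has bounded speed in a short time. -/
theorem IsFlow.mem_ball {f : ℝ → EucSpace n} {a b r B : ℝ} {z : EucSpace n} (hf : H.IsFlow f a b)
    (hab : a ≤ b) (hB0 : 0 ≤ B) (hz : dist (f a) z < r / 2) (hB : B * (b - a) < r / 2)
    (hF : ∀ y ∈ Metric.ball z r, y ∈ H.C → ∀ v ∈ H.F y, ‖v‖ ≤ B) :
    ∀ s ∈ Icc a b, f s ∈ Metric.ball z r := by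
  by_contra! hcon
  have hc : ContinuousOn f (Icc a b) := uIcc_of_le hab ▸ hf.ac.continuousOn
  have hK : IsCompact (Icc a b ∩ f ⁻¹' (Metric.ball z r)ᶜ) := by
    refine isCompact_Icc.of_isClosed_subset ?_ inter_subset_left
    exact ContinuousOn.preimage_isClosed_of_isClosed hc isClosed_Icc Metric.isOpen_ball.isClosed_compl
  -- The first exit time: before it the speed bound holds, so the distance covered is too small to
  -- reach the boundary.
  obtain ⟨s, ⟨hs, hsr⟩, hmin⟩ := hK.exists_isLeast (by
    obtain ⟨s, hs, hsr⟩ := hcon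
    exact ⟨s, hs, hsr⟩)
  have hd := (hf.mono le_rfl hs.1 hs.2).dist_le hs.1 (M := B) fun t ht => by
    have htI : t ∈ Icc a b := ⟨ht.1.le, ht.2.le.trans hs.2⟩
    refine hF (f t) ?_ (hf.mem t ⟨ht.1, ht.2.trans_le hs.2⟩)
    by_contra hout
    exact absurd (hmin ⟨htI, hout⟩) (not_le.2 ht.2)
  have h1 := dist_triangle_left (f s) z (f a)
  have h2 : B * (s - a) ≤ B * (b - a) := by gcongr; exact hs.2
  have h3 : r ≤ dist (f s) z := not_lt.1 hsr
  linarith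

end HybridSystem

/-! ### Continuation along the boundary and openness -/

namespace HybridSystem

variable {n : ℕ} {H : HybridSystem n} {U A : Set (EucSpace n)}

theorem mem_safeBasin_of_notMem {x : EucSpace n} (hx : x ∉ closure H.C ∪ H.D) :
    x ∈ H.safeBasin U A :=
  mem_safeBasin_iff.2 fun _ hφ h0 => absurd (h0 ▸ hφ.init) hx

/-- On a ball where the speed is bounded by `B`, the initial flow of a solution stays in the ball
for a short time, is Lipschitz there. -/
theorem IsSolution.initial_flow {φ : HybridArc n} (hφ : H.IsSolution φ)
    {r t : ℝ} {B : NNReal} {z : EucSpace n} (ht : (t, 0) ∈ φ.dom)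
    (hz : dist (φ.toFun 0 0) z < r / 2) (hB : (B : ℝ) * t < r / 2)
    (hF : ∀ y ∈ Metric.ball z r, y ∈ H.C → ∀ v ∈ H.F y, ‖v‖ ≤ B) :
    H.IsFlow (fun s => φ.toFun s 0) 0 t ∧ (∀ s ∈ Icc 0 t, φ.toFun s 0 ∈ Metric.ball z r) ∧
      LipschitzOnWith B (fun s => φ.toFun s 0) (Icc 0 t) := by
  have ht0 := φ.dom_intrinsic.nonneg _ _ ht
  have hflow := hφ.isFlow φ.dom_intrinsic.zero_mem ht ht0
  have hball := hflow.mem_ball ht0 B.2 hz (by simpa using hB) hF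
  refine ⟨hflow, hball, LipschitzOnWith.of_dist_le_mul fun s hs u hu => ?_⟩
  wlog hsu : s ≤ u generalizing s u
  · rw [dist_comm, dist_comm s]
    exact this u hu s hs (le_of_not_ge hsu)
  rw [dist_comm s, Real.dist_eq, abs_of_nonneg (sub_nonneg.2 hsu)]
  refine (hflow.mono hs.1 hsu hu.2).dist_le hsu fun σ hσ => ?_
  have hσ' : σ ∈ Ioo 0 t := ⟨hs.1.trans_lt hσ.1, hσ.2.trans_le hu.2⟩
  exact hF _ (hball σ (Ioo_subset_Icc_self hσ')) (hflow.mem σ hσ')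

/-- From a safe boundary point there is a nontrivial solution that does not enter the interior of
the safe part of the basin. -/
theorem BasicConditions.exists_isSolution_boundary (hH : H.BasicConditions) (hU : IsClosed U)
    {z : EucSpace n} (hzg : z ∈ H.safeBasin U A \ U)
    (hzc : z ∈ closure (H.safeBasin U A \ U)ᶜ) :
    ∃ χ : HybridArc n, H.IsSolution χ ∧ χ.toFun 0 0 = z ∧
      χ.rge ⊆ closure (H.safeBasin U A \ U)ᶜ ∧ ∃ p ∈ χ.dom, p ≠ (0, 0) := by
  set Bad : Set (EucSpace n) := (H.safeBasin U A \ U)ᶜ with hBad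
  have hC := hH.isClosed_C
  obtain ⟨𝒰, hle⟩ := mem_closure_iff_ultrafilter.1 hzc
  obtain ⟨h𝒰B, h𝒰z⟩ := hle
  obtain ⟨B₀, hB₀⟩ := hH.locallyBounded_F.exists_norm_le_of_isClosed hC z
  obtain ⟨r, hr, hball⟩ := Metric.eventually_nhds_iff_ball.1
    (hB₀.and (hU.isOpen_compl.eventually_mem hzg.2))
  let B : NNReal := ⟨max B₀ 1, le_max_of_le_right zero_le_one⟩
  have hB1 : (1 : ℝ) ≤ B := le_max_right _ _
  have hBpos : (0 : ℝ) < B := one_pos.trans_le hB1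
  have hF : ∀ y ∈ Metric.ball z r, y ∈ H.C → ∀ v ∈ H.F y, ‖v‖ ≤ B := fun y hy hyC v hv =>
    ((hball y hy).1 hyC v hv).trans (le_max_left _ _)
  have hrU : Disjoint (Metric.ball z r) U := disjoint_left.2 fun y hy => (hball y hy).2
  -- Up to time `τ` a flow of speed at most `B` travels at most `r / 4`, so one started within `r /
  -- 2` of `z` stays in the ball; `B ≥ 1` makes the division legitimate.
  let τ : ℝ := r / (4 * B)
  have hτ : 0 < τ := by positivity
  have hBτ : ∀ t ≤ τ, (B : ℝ) * t < r / 2 := by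
    intro t ht
    have h1 : (B : ℝ) * t ≤ B * τ := by gcongr
    have h2 : (B : ℝ) * τ = r / 4 := by simp only [τ]; field_simp
    linarith
  have hex : ∀ᶠ y in (𝒰 : Filter (EucSpace n)), ∃ φ : HybridArc n, H.IsSolution φ ∧
      φ.toFun 0 0 = y ∧ ¬ φ.IsSafelyAttracted U A ∧ dist y z < r / 2 := by
    filter_upwards [h𝒰B, h𝒰z (Metric.ball_mem_nhds z (half_pos hr))] with y hyB hyz
    have hyr : y ∈ Metric.ball z r := Metric.ball_subset_ball (by linarith) hyz
    have : y ∉ H.safeBasin U A := fun h => hyB ⟨h, disjoint_left.1 hrU hyr⟩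
    rw [mem_safeBasin_iff] at this
    push Not at this
    obtain ⟨φ, hφ, h0, hbad⟩ := this
    exact ⟨φ, hφ, h0, hbad, hyz⟩
  obtain ⟨φ, hφ⟩ := hex.choice
  have hinit : z ∈ closure H.C ∪ H.D :=
    (isClosed_closure.union hH.isClosed_D).mem_of_tendsto (f := fun y => y) (b := 𝒰) h𝒰z (by
      filter_upwards [hφ] with y hy
      exact hy.2.1 ▸ hy.1.init)
  -- The ultrafilter decides: either most bad solutions flow for a common positive time, or for each
  -- positive `t ≤ τ` most have stopped flowing at level 0 before `t`.
  by_cases hcase : ∃ t, 0 < t ∧ t ≤ τ ∧ ∀ᶠ y in (𝒰 : Filter (EucSpace n)), (t, 0) ∈ (φ y).dom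
  · obtain ⟨t, ht0, htτ, htd⟩ := hcase
    have hev : ∀ᶠ y in (𝒰 : Filter (EucSpace n)), (φ y).toFun 0 0 = y ∧
        H.IsFlow (fun s => (φ y).toFun s 0) 0 t ∧
        (∀ s ∈ Icc 0 t, (φ y).toFun s 0 ∈ Metric.ball z r) ∧
        LipschitzOnWith B (fun s => (φ y).toFun s 0) (Icc 0 t) ∧
        ∀ s ∈ Icc 0 t, (φ y).toFun s 0 ∈ Bad := by
      filter_upwards [hφ, htd] with y ⟨hy, hy0, hybad, hyz⟩ hyd
      obtain ⟨h1, h2, h3⟩ := hy.initial_flow hyd (hy0.symm ▸ hyz) (hBτ t htτ) hF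
      have a := (φ y).dom_intrinsic
      refine ⟨hy0, h1, h2, h3, fun s hs => hy.notMem_safeBasin_diff hC hybad
        (a.ordConnected 0 0 t s a.zero_mem hyd hs.1 hs.2) Metric.isBounded_ball hrU
        fun u j hu hus hj => Or.inl ?_⟩
      obtain rfl : j = 0 := Nat.le_zero.1 hj
      exact h2 u ⟨a.nonneg _ _ hu, hus.trans hs.2⟩
    have hlim : ∀ s, ∃ w, s ∈ Icc 0 t →
        Tendsto (fun y => (φ y).toFun s 0) (𝒰 : Filter (EucSpace n)) (𝓝 w) := by
      intro s
      by_cases hs : s ∈ Icc 0 t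
      · obtain ⟨w, -, hw⟩ := exists_tendsto_of_eventually_mem_closedBall 𝒰
          (u := fun y => (φ y).toFun s 0) (c := z) (B := r)
          (hev.mono fun y hy => Metric.ball_subset_closedBall (hy.2.2.1 s hs))
        exact ⟨w, fun _ => hw⟩
      · exact ⟨0, fun h => absurd h hs⟩
    choose g hg using hlim
    have hflow : H.IsFlow g 0 t := IsFlow.of_tendsto hH ht0.le (hev.mono fun y hy => hy.2.2.2.1)
      (hev.mono fun y hy => hy.2.1) hg
    have hg0 : g 0 = z := tendsto_nhds_unique (hg 0 ⟨le_rfl, ht0.le⟩)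
      (Tendsto.congr' (hev.mono fun y hy => hy.1.symm) (h𝒰z : Tendsto (fun y => y) _ _))
    obtain ⟨χ, hχ, hdom, hval⟩ := hflow.exists_isSolution ht0.le (hg0.symm ▸ hinit)
    refine ⟨χ, hχ, (hval 0).trans hg0, ?_, (t, 0), (hdom t 0).2 ⟨rfl, ht0.le, le_rfl⟩,
      fun h => ht0.ne' (congrArg Prod.fst h)⟩
    rintro _ ⟨s, j, hd, rfl⟩
    obtain ⟨rfl, hs⟩ := (hdom s j).1 hd
    rw [hval]
    exact mem_closure_of_tendsto (hg s hs) (hev.mono fun y hy => hy.2.2.2.2 s hs)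
  · have hcase' : ∀ t, 0 < t → t ≤ τ → ∀ᶠ y in (𝒰 : Filter (EucSpace n)), (t, 0) ∉ (φ y).dom :=
      fun t ht0 htτ => Ultrafilter.eventually_not.2 fun hd => hcase ⟨t, ht0, htτ, hd⟩
    -- Without a jump the solution would be confined to the ball during `[0, τ)`: bounded, off `U`
    -- and not complete, hence safely attracted.
    have hjump : ∀ᶠ y in (𝒰 : Filter (EucSpace n)), ∃ s, (s, 0) ∈ (φ y).dom ∧
        (s, 1) ∈ (φ y).dom := by
      filter_upwards [hφ, hcase' τ hτ le_rfl] with y ⟨hy, hy0, hybad, hyz⟩ hyτ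
      by_contra! hno
      apply hybad
      have a := (φ y).dom_intrinsic
      have hj : ∀ j s, (s, j) ∈ (φ y).dom → j = 0 := by
        intro j
        induction j with
        | zero => exact fun _ _ => rfl
        | succ j ih =>
          intro s hs
          obtain ⟨u, hu, hu'⟩ := a.exists_jump s j hs
          obtain rfl := ih u hu
          exact absurd hu' (hno u hu)
      have hlt : ∀ s, (s, 0) ∈ (φ y).dom → s < τ := fun s hs => by
        by_contra hc
        exact hyτ (a.ordConnected 0 0 s τ a.zero_mem hs hτ.le (not_lt.1 hc))
      have hin : ∀ s j, (s, j) ∈ (φ y).dom → (φ y).toFun s j ∈ Metric.ball z r := by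
        intro s j hs
        obtain rfl := hj j s hs
        exact (hy.initial_flow hs (hy0.symm ▸ hyz) (hBτ s (hlt s hs).le) hF).2.1 s
          ⟨a.nonneg _ _ hs, le_rfl⟩
      refine ⟨Metric.isBounded_ball.subset (s := (φ y).rge) (t := Metric.ball z r) ?_,
        fun hc => ?_, fun s j hs => disjoint_left.1 hrU (hin s j hs)⟩
      · rintro _ ⟨s, j, hs, rfl⟩
        exact hin s j hs
      · obtain ⟨s, j, hs, hle⟩ := hc τ
        obtain rfl := hj j s hs
        have := hlt s hs
        simp only [Nat.cast_zero, add_zero] at hle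
        linarith
    obtain ⟨s, hs⟩ := hjump.choice
    have hslt : ∀ t, 0 < t → t ≤ τ → ∀ᶠ y in (𝒰 : Filter (EucSpace n)), s y < t := by
      intro t ht0 htτ
      filter_upwards [hs, hcase' t ht0 htτ] with y hy hyt
      by_contra hc
      have a := (φ y).dom_intrinsic
      exact hyt (a.ordConnected 0 0 (s y) t a.zero_mem hy.1 ht0.le (not_lt.1 hc))
    have hev : ∀ᶠ y in (𝒰 : Filter (EucSpace n)),
        (∀ u ∈ Icc 0 (s y), (φ y).toFun u 0 ∈ Metric.ball z r) ∧
        dist y ((φ y).toFun (s y) 0) ≤ B * s y ∧ (φ y).toFun (s y) 0 ∈ H.D ∧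
        (φ y).toFun (s y) 1 ∈ H.G ((φ y).toFun (s y) 0) ∧ (φ y).toFun (s y) 1 ∈ Bad := by
      filter_upwards [hφ, hs, hslt τ hτ le_rfl] with y ⟨hy, hy0, hybad, hyz⟩ ⟨hs0, hs1⟩ hsτ
      have a := (φ y).dom_intrinsic
      have hsn := a.nonneg _ _ hs0
      obtain ⟨h1, h2, h3⟩ := hy.initial_flow hs0 (hy0.symm ▸ hyz) (hBτ _ hsτ.le) hF
      have h4 := h3.dist_le_mul 0 ⟨le_rfl, hsn⟩ (s y) ⟨hsn, le_rfl⟩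
      rw [dist_comm (0 : ℝ), Real.dist_eq, sub_zero, abs_of_nonneg hsn, hy0] at h4
      obtain ⟨h5, h6⟩ := hy.jump (s y) 0 hs0 hs1
      refine ⟨h2, h4, h5, h6, hy.notMem_safeBasin_diff hC hybad hs1 Metric.isBounded_ball hrU
        fun u j hu hus hj => ?_⟩
      rcases Nat.le_one_iff_eq_zero_or_eq_one.1 hj with rfl | rfl
      · exact Or.inl (h2 u ⟨a.nonneg _ _ hu, hus⟩)
      -- The landing point may leave the ball. At level 1, time is at least `s y`, so up to `(s y,
      -- 1)` it is the only point there.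
      · exact Or.inr (by rw [le_antisymm hus (a.le_of_succ _ _ _ hs0 hu)])
    have htend : Tendsto (fun y => (φ y).toFun (s y) 0) (𝒰 : Filter (EucSpace n)) (𝓝 z) := by
      refine Metric.tendsto_nhds.2 fun ε hε => ?_
      have ht0 : 0 < min τ (ε / (2 * B)) := by positivity
      filter_upwards [hev, hslt _ ht0 (min_le_left _ _),
        h𝒰z (Metric.ball_mem_nhds z (half_pos hε))] with y hy hsy hyz
      have h1 : (B : ℝ) * s y ≤ B * (ε / (2 * B)) := by
        gcongr
        exact hsy.le.trans (min_le_right _ _)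
      have h2 : (B : ℝ) * (ε / (2 * B)) = ε / 2 := by field_simp
      have h3 := dist_triangle_left ((φ y).toFun (s y) 0) z y
      have h4 : dist y z < ε / 2 := hyz
      linarith [hy.2.1]
    have hzD : z ∈ H.D := hH.isClosed_D.mem_of_tendsto htend (hev.mono fun y hy => hy.2.2.1)
    obtain ⟨B', hB'⟩ := hH.locallyBounded_G.exists_norm_le hzD
    obtain ⟨w, -, hw⟩ := exists_tendsto_of_eventually_mem_closedBall 𝒰
      (u := fun y => (φ y).toFun (s y) 1) (c := 0) (B := B') (by
        filter_upwards [hev, htend.eventually hB'] with y hy hyB'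
        exact mem_closedBall_zero_iff.2 (hyB' hy.2.2.1 _ hy.2.2.2.1))
    have hwG : w ∈ H.G z := hH.osc_G.mem_of_tendsto hzD (hev.mono fun y hy => hy.2.2.1)
      (hev.mono fun y hy => hy.2.2.2.1) htend hw
    obtain ⟨χ, hχ, hdom, hχ0, hχ1⟩ := exists_isSolution_of_jump hzD hwG
    refine ⟨χ, hχ, hχ0, ?_, (0, 1), (hdom 0 1).2 ⟨rfl, le_rfl⟩, by simp⟩
    rintro _ ⟨u, j, hd, rfl⟩
    obtain ⟨rfl, hj⟩ := (hdom u j).1 hd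
    rcases Nat.le_one_iff_eq_zero_or_eq_one.1 hj with rfl | rfl
    · rwa [hχ0]
    · rw [hχ1]
      exact mem_closure_of_tendsto hw (hev.mono fun y hy => hy.2.2.2.2)

/-- A bounded solution whose last flow interval is right-open with right endpoint `b` extends to time
`b`. -/
theorem IsSolution.exists_extension_of_isLUB {ψ : HybridArc n} (hH : H.BasicConditions)
    (hψ : H.IsSolution ψ) (hbd : Bornology.IsBounded ψ.rge) {S : Set (EucSpace n)}
    (hS : IsClosed S) (hψS : ψ.rge ⊆ S) {J : ℕ} (hJ : ∀ t j, (t, j) ∈ ψ.dom → j ≤ J)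
    (hne : (ψ.flowInterval J).Nonempty) {b : ℝ} (hb : IsLUB (ψ.flowInterval J) b)
    (hbn : (b, J) ∉ ψ.dom) :
    ∃ χ : HybridArc n, H.IsSolution χ ∧ χ.rge ⊆ S ∧ χ.Extends ψ ∧ (b, J) ∈ χ.dom := by
  have hC := hH.isClosed_C
  have a := ψ.dom_intrinsic
  obtain ⟨c, hc⟩ := hne
  have hlt : ∀ t, (t, J) ∈ ψ.dom → t < b := fun t ht =>
    lt_of_le_of_ne (hb.1 ht) fun h => hbn (h ▸ ht)
  have hcb : c < b := hlt c hc
  have hmem : ∀ t, c ≤ t → t < b → (t, J) ∈ ψ.dom := fun t hct htb => by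
    obtain ⟨u, hu, htu, -⟩ := hb.exists_between htb
    exact a.ordConnected J c u t hc hu hct htu.le
  obtain ⟨B₀, hB₀⟩ := hH.locallyBounded_F.exists_norm_le_of_isBounded hC hbd
  let B : NNReal := ⟨max B₀ 0, le_max_right _ _⟩
  have hlip : LipschitzOnWith B (fun t => ψ.toFun t J) (Ico c b) := by
    refine LipschitzOnWith.of_dist_le_mul fun s hs u hu => ?_
    wlog hsu : s ≤ u generalizing s u
    · rw [dist_comm, dist_comm s]
      exact this u hu s hs (le_of_not_ge hsu)
    have hflow := hψ.isFlow (hmem s hs.1 hs.2) (hmem u hu.1 hu.2) hsu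
    rw [dist_comm s, Real.dist_eq, abs_of_nonneg (sub_nonneg.2 hsu)]
    refine hflow.dist_le hsu fun σ hσ v hv => ?_
    exact (hB₀ _ ⟨σ, J, hmem σ (hs.1.trans hσ.1.le) (hσ.2.trans hu.2), rfl⟩ (hflow.mem σ hσ) v
      hv).trans (le_max_left _ _)
  -- A Lipschitz extension supplies the missing value at `b`.
  obtain ⟨g, hg, hgeq⟩ := hlip.extend_finite_dimension
  have hgflow' : ∀ u v, c ≤ u → u ≤ v → v < b → H.IsFlow g u v := fun u v hu huv hv =>
    (hψ.isFlow (hmem u hu (huv.trans_lt hv)) (hmem v (hu.trans huv) hv) huv).congr huv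
      fun t ht => hgeq ⟨hu.trans ht.1, ht.2.trans_lt hv⟩
  have hgC : ∀ t ∈ Ico c b, g t ∈ H.C := fun t ht => by
    obtain ⟨u, htu, hub⟩ := exists_between ht.2
    exact (hgflow' t u ht.1 htu.le hub).mem_Icc hC htu t ⟨le_rfl, htu.le⟩
  have hgflow : H.IsFlow g c b := by
    refine ⟨(hg.lipschitzOnWith (s := uIcc c b)).absolutelyContinuousOnInterval,
      fun t ht => hgC t (Ioo_subset_Ico_self ht), ?_⟩
    have := ae_mem_of_forall_Ioo (S := Ioo c b) ordConnected_Ioo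
      fun u hu v hv huv => (hgflow' u v hu.1.le huv hv.2).ae_deriv
    exact this
  have hgS : ∀ t ∈ Icc c b, g t ∈ S := by
    intro t ht
    rw [← closure_Ico hcb.ne] at ht
    refine hS.closure_subset (map_mem_closure hg.continuous ht fun u hu => ?_)
    rw [← hgeq hu]
    exact hψS ⟨u, J, hmem u hu.1 hu.2, rfl⟩
  have hshift : H.IsFlow (fun t => g (t + c)) 0 (b - c) := by
    have h : H.IsFlow g (0 - -c) (b - c - -c) := by simpa using hgflow
    simpa using h.comp_sub_const (-c)
  obtain ⟨χ, hχ, hχdom, hχval⟩ := hshift.exists_isSolution (sub_nonneg.2 hcb.le) (by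
    rw [zero_add]
    exact Or.inl (subset_closure (hgC c ⟨le_rfl, hcb⟩)))
  obtain ⟨ω, hω, hdom, hω1, hω2⟩ := hψ.exists_concat hC hχ hc (by
    rw [hχval, zero_add]
    exact (hgeq ⟨le_rfl, hcb⟩).symm)
  have hω2' : ∀ t ∈ Icc c b, (t, J) ∈ ω.dom ∧ ω.toFun t J = g t := by
    intro t ht
    have hd : (t - c, 0) ∈ χ.dom :=
      (hχdom _ _).2 ⟨rfl, sub_nonneg.2 ht.1, sub_le_sub_right ht.2 c⟩
    refine ⟨(hdom t J).2 (Or.inr ⟨le_rfl, by simpa using hd⟩), ?_⟩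
    have := hω2 _ _ hd
    rwa [hχval, sub_add_cancel, zero_add] at this
  have hsplit : ∀ t j, (t, j) ∈ ψ.dom → (t ≤ c ∧ j ≤ J) ∨ (c ≤ t ∧ j = J) := fun t j hd =>
    (a.le_total hd hc).imp id fun h => ⟨h.1, le_antisymm (hJ t j hd) h.2⟩
  refine ⟨ω, hω, ?_, ⟨fun p hp => ?_, fun t j hd => ?_⟩, (hω2' b ⟨hcb.le, le_rfl⟩).1⟩
  · rintro _ ⟨t, j, hd, rfl⟩
    rcases (hdom t j).1 hd with ⟨h1, h2, h3⟩ | ⟨h1, h2⟩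
    · rw [hω1 t j h1 h2 h3]
      exact hψS ⟨t, j, h1, rfl⟩
    · obtain ⟨h3, h4, h5⟩ := (hχdom _ _).1 h2
      obtain rfl : j = J := by omega
      have ht : t ∈ Icc c b := ⟨by linarith, by linarith⟩
      rw [(hω2' t ht).2]
      exact hgS t ht
  · rcases hsplit p.1 p.2 hp with h | ⟨h, h'⟩
    · exact (hdom _ _).2 (Or.inl ⟨hp, h⟩)
    · obtain ⟨t, j⟩ := p
      dsimp at h h'
      subst h'
      exact (hω2' t ⟨h, (hlt t hp).le⟩).1
  · rcases hsplit t j hd with h | ⟨h, rfl⟩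
    · exact (hω1 t j hd h.1 h.2).symm
    · rw [(hω2' t ⟨h, (hlt t hd).le⟩).2]
      exact hgeq ⟨h, hlt t hd⟩

theorem BasicConditions.isOpen_safeBasin (hH : H.BasicConditions) (hA : IsCompact A)
    (hU : IsClosed U) (hAU : A ∩ U = ∅) (hst : H.UpAS A) : IsOpen (H.safeBasin U A) := by
  have hC := hH.isClosed_C
  rw [← isClosed_compl_iff]
  refine isClosed_of_closure_subset fun x hxc hx => ?_
  set S := closure (H.safeBasin U A \ U)ᶜ with hS
  have hxS : x ∈ S := closure_mono (compl_subset_compl.2 sdiff_subset) hxc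
  have hinit : x ∈ closure H.C ∪ H.D := by
    refine (isClosed_closure.union hH.isClosed_D).closure_subset_iff.2 (fun y hy => ?_) hxc
    by_contra hc
    exact hy (mem_safeBasin_of_notMem hc)
  -- The solution consisting of the single point `x` seeds Zorn's lemma.
  obtain ⟨φ, hφ, hφdom, hφval⟩ := IsFlow.exists_isSolution (H := H) (f := fun _ => x) le_rfl hinit
    (IsFlow.refl _ _ _)
  have hφS : φ.rge ⊆ S := by
    rintro _ ⟨t, j, hd, rfl⟩
    obtain ⟨rfl, -⟩ := (hφdom t j).1 hd
    rwa [hφval]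
  obtain ⟨ψ, hψ, hψS, hext, hmax⟩ := hφ.exists_maximal_extension hφS
  have hψ0 : ψ.toFun 0 0 = x := (hext.2 0 0 φ.dom_intrinsic.zero_mem).symm.trans (hφval 0)
  have hsafe := mem_safeBasin_iff.1 hx ψ hψ hψ0
  have a := ψ.dom_intrinsic
  have hnc : ¬ ψ.IsComplete := by
    intro hc
    obtain ⟨ε, hε, hsub⟩ := hst.exists_thickening_subset hA hU hAU
    obtain ⟨T, hT⟩ := hsafe.convergesTo hc ε hε
    obtain ⟨t, j, hd, hle⟩ := hc T
    have h1 : ψ.toFun t j ∈ Metric.thickening ε A := hT t j hd hle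
    have h2 : ψ.toFun t j ∈ S := hψS ⟨t, j, hd, rfl⟩
    -- An open set that meets the closure `S` meets the complement of `safeBasin \ U` itself.
    obtain ⟨y, hy, hy'⟩ := mem_closure_iff.1 h2 _ Metric.isOpen_thickening h1
    exact hy' (hsub hy)
  simp only [HybridArc.IsComplete, not_forall, not_exists, not_and, not_le] at hnc
  obtain ⟨T, hT⟩ := hnc
  have hbdd : BddAbove {j | ∃ t, (t, j) ∈ ψ.dom} := by
    refine ⟨⌈T⌉₊, fun j ⟨t, hd⟩ => ?_⟩
    have := (hT t j hd).le.trans (Nat.le_ceil T)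
    exact_mod_cast (by linarith [a.nonneg t j hd] : (j : ℝ) ≤ ⌈T⌉₊)
  have hJmem := Nat.sSup_mem (s := {j | ∃ t, (t, j) ∈ ψ.dom}) ⟨0, 0, a.zero_mem⟩ hbdd
  set J := sSup {j | ∃ t, (t, j) ∈ ψ.dom} with hJdef
  have hJ : ∀ t j, (t, j) ∈ ψ.dom → j ≤ J := fun t j hd => le_csSup hbdd ⟨t, hd⟩
  have hne : (ψ.flowInterval J).Nonempty := hJmem
  have hlub := isLUB_csSup hne ⟨T, fun t hd => by
    linarith [hT t J hd, (Nat.cast_nonneg J : (0 : ℝ) ≤ J)]⟩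
  set b := sSup (ψ.flowInterval J) with hbdef
  have hbJ : (b, J) ∈ ψ.dom := by
    by_contra hbn
    obtain ⟨χ, hχ, hχS, hχext, hbχ⟩ := hψ.exists_extension_of_isLUB hH hsafe.isBounded
      isClosed_closure hψS hJ hne hlub hbn
    exact hbn (hmax χ hχ hχS hχext hbχ)
  have hend : ∀ t j, (t, j) ∈ ψ.dom → t ≤ b ∧ j ≤ J := by
    intro t j hd
    refine ⟨?_, hJ t j hd⟩
    rcases (hJ t j hd).lt_or_eq with h | rfl
    exacts [a.le_of_lt hd hbJ h, hlub.1 hd]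
  obtain ⟨χ, hχ, hχ0, hχS, p, hp, hp0⟩ := hH.exists_isSolution_boundary hU
    (hψ.mem_safeBasin_diff hC (hψ0.symm ▸ hx) hbJ) (hψS ⟨b, J, hbJ, rfl⟩)
  obtain ⟨ω, hω, hdom, hω1, hω2⟩ := hψ.exists_concat hC hχ hbJ hχ0
  have hωS : ω.rge ⊆ S := by
    rintro _ ⟨t, j, hd, rfl⟩
    rcases (hdom t j).1 hd with ⟨h1, h2, h3⟩ | ⟨h1, h2⟩
    · rw [hω1 t j h1 h2 h3]
      exact hψS ⟨t, j, h1, rfl⟩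
    · have := hω2 _ _ h2
      rw [sub_add_cancel, Nat.sub_add_cancel h1] at this
      rw [this]
      exact hχS ⟨_, _, h2, rfl⟩
  have hωext : ω.Extends ψ :=
    ⟨fun p hp => (hdom p.1 p.2).2 (Or.inl ⟨hp, hend p.1 p.2 hp⟩), fun t j hd =>
      (hω1 t j hd (hend t j hd).1 (hend t j hd).2).symm⟩
  -- Maximality puts the shifted point `p` inside the domain of `ψ`, whose last point is `(b, J)`;
  -- this forces `p = (0, 0)`.
  have hlast := hend (p.1 + b) (p.2 + J) (hmax ω hω hωS hωext
    ((hdom _ _).2 (Or.inr ⟨Nat.le_add_left _ _, by simpa using hp⟩)))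
  refine hp0 (Prod.ext (le_antisymm (by linarith [hlast.1]) (χ.dom_intrinsic.nonneg _ _ hp)) ?_)
  have := hlast.2
  dsimp
  omega

end HybridSystem

theorem mainTheorem9 {n : ℕ} (H : HybridSystem n) (δ : ℝ) (hδ : 0 ≤ δ)
    (hbasic : (H.perturb δ).BasicConditions)
    (X₀ U A : Set (EucSpace n)) (hA : IsCompact A) (hU : IsClosed U) (hAU : A ∩ U = ∅)
    (hspec : (H.perturb δ).StabilityWithSafety X₀ U A) :
    (X₀ ⊆ (H.perturb δ).safeBasin U A ∧
      (H.perturb δ).safeBasin U A ⊆ (H.perturb δ).basin A) ∧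
    (IsOpen ((H.perturb δ).safeBasin U A) ∧
      (H.perturb δ).ForwardPreInvariant ((H.perturb δ).safeBasin U A)) :=
  ⟨⟨fun _ hx => ⟨hspec.subset_basin hx, fun φ hφ => hspec.safe φ
    ⟨hφ.1, (hφ.2 : φ.toFun 0 0 = _) ▸ hx⟩⟩, fun _ hx => hx.1⟩,
    hbasic.isOpen_safeBasin hA hU hAU hspec.upAS,
    HybridSystem.forwardPreInvariant_safeBasin hbasic.isClosed_C⟩
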